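/- Let \(a(n)>0\) and \(b(n)\in\mathbb R\) for \(n\in\mathbb Z\), let \((\tau f)(n)=a(n)f(n+1)+a(n-1)f(n-1)+b(n)f(n)\) and \(W(f,g)(n)=a(n)\big(f(n)g(n+1)-f(n+1)g(n)\big)\). Let \(H\) be a self-adjoint operator in \(\ell^2(\mathbb Z)\) associated with \(\tau\) and separated boundary conditions. Its boundary condition at \(-\infty\) is described by some \(z_0\in\mathbb C\setminus\mathbb R\) and a nontrivial solution \(u\) of \(\tau u=z_0u\) which is square summable near \(-\infty\) and satisfies \(\lim_{n\to-\infty}W(u^*,u)(n)=0\): a sequence \(f\) lies in the domain of \(H\) near \(-\infty\) if \(f\) and \(\tau f\) are square summable near \(-\infty\) and \(\lim_{n\to-\infty}W(u,f)(n)=0\) (if \(\tau\) is limit point at \(-\infty\), both limit conditions hold automatically). Let \(\phi(z,n)\) be a real entire solution of \(\tau\phi(z)=z\phi(z)\), that is, each \(\phi(\cdot,n)\) is entire with \(\phi(z^*,n)=\phi(z,n)^*\), such that for every \(z\in\mathbb C\) the sequence \(\phi(z,\cdot)\) is nontrivial and lies in the domain of \(H\) near \(-\infty\). For \(n\in\mathbb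 Z\) let \(\ell^2(-\infty,n]\) be the space of all \(f\in\ell^2(\mathbb Z)\) which vanish on \(m>n\), and for such \(f\) let \[\hat f(z)=\sum_{m\le n}\phi(z,m)f(m),\qquad z\in\mathbb C .\] Put \[E(z,n)=\phi(z,n)-\mathrm i\,a(n)\,\phi(z,n+1).\] Theorem. For every \(n\in\mathbb Z\) the following hold. The function \(E(\cdot,n)\) is a de Branges function, that is, it is entire with \(|E(z,n)|>|E(z^*,n)|\) for \(\operatorname{Im}z>0\). Let \(B(n)\) be its de Branges space, consisting of all entire \(F\) with \(\int_{\mathbb R}|F(\lambda)/E(\lambda,n)|^2d\lambda<\infty\) such that \(F/E(\cdot,n)\) and \(F^\#/E(\cdot,n)\) belong to the Hardy space \(H^2\) of the upper half-plane, where \(F^\#(z)=F(z^*)^*\), with the inner product \[\langle F,G\rangle_{B(n)}=\frac1\pi\int_{\mathbb R}\frac{F(\lambda)^*G(\lambda)}{|E(\lambda,n)|^2}\,d\lambda .\] Then the series defining \(\hat f(z)\) converges absolutely for all \(f\in\ell^2(-\infty,n]\) and \(z\in\mathbb C\), and \(f\mapsto\hat f\) is unitary from \(\ell^2(-\infty,n]\)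 onto \(B(n)\). In particular, \(\phi(\cdot,m)\in B(n)\) for all \(m\le n\), and \[B(n)=\{\hat f\mid f\in\ell^2(-\infty,n]\}=\overline{\operatorname{span}\{\phi(\cdot,m)\mid m\le n\}},\] with the closure taken in \(B(n)\). -/

import Mathlib

open Complex MeasureTheory Filter Topology
open scoped ComplexConjugate NNReal ENNReal

noncomputable section

/-! ### Jacobi difference expressions on `ℤ` -/

/-- The Jacobi difference expression
`(τ f)(n) = a(n) f(n+1) + a(n-1) f(n-1) + b(n) f(n)`. -/
def jacobiTau (a b : ℤ → ℝ) (f : ℤ → ℂ) (n : ℤ) : ℂ :=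
  a n * f (n + 1) + a (n - 1) * f (n - 1) + b n * f n

/-- The (modified) Wronskian `W(f,g)(n) = a(n) (f(n) g(n+1) - f(n+1) g(n))`. -/
def jacobiWronskian (a : ℤ → ℝ) (f g : ℤ → ℂ) (n : ℤ) : ℂ :=
  a n * (f n * g (n + 1) - f (n + 1) * g n)

/-- The sequence is square summable near `-∞`. -/
def SqSummableNearBot (f : ℤ → ℂ) : Prop :=
  Summable fun k : ℕ => ‖f (-(k : ℤ))‖ ^ 2

/-- `u` is a solution `u_-(z₀, ·)` at the non-real point `z₀` which fixes a self-adjoint boundary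
condition at `-∞`: a nontrivial solution of `τ u = z₀ u` that is square summable near `-∞` and with
`W(u*, u) → 0` at `-∞`.  If `τ` is limit point at `-∞`, the last requirement holds
automatically and `u` is the Weyl solution, unique up to a factor; if `τ` is limit circle at `-∞`,
these `u` parametrize exactly the self-adjoint boundary conditions at `-∞`. -/
structure IsLeftBoundarySolution (a b : ℤ → ℝ) (z₀ : ℂ) (u : ℤ → ℂ) : Prop where
  nonreal : z₀.im ≠ 0
  solution : ∀ n, jacobiTau a b u n = z₀ * u n
  nontrivial : u ≠ 0
  sqSummable : SqSummableNearBot u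
  selfAdjoint : Tendsto (jacobiWronskian a (fun n => conj (u n)) u) atBot (𝓝 0)

/-- `f` lies, near `-∞`, in the domain of the self-adjoint Jacobi operator whose boundary condition
at `-∞` is the one satisfied by `u = u_-(z₀, ·)`: both `f` and `τ f` are square summable
near `-∞`, and `W(u, f) → 0` at `-∞` (which is automatic in the limit point case). -/
structure InDomainNearBot (a b : ℤ → ℝ) (u f : ℤ → ℂ) : Prop where
  sqSummable : SqSummableNearBot f
  sqSummable_tau : SqSummableNearBot (jacobiTau a b f)
  boundary : Tendsto (jacobiWronskian a u f) atBot (𝓝 0)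

/-- `φ(z, n)` is a real entire solution of `τ φ(z) = z φ(z)` which, for every `z ∈ ℂ`, is nontrivial
and lies in the domain of the operator near `-∞`. -/
structure IsRealEntireSolution (a b : ℤ → ℝ) (u : ℤ → ℂ) (φ : ℂ → ℤ → ℂ) : Prop where
  entire : ∀ n, Differentiable ℂ fun z => φ z n
  real : ∀ z n, φ (conj z) n = conj (φ z n)
  solution : ∀ z n, jacobiTau a b (φ z) n = z * φ z n
  nontrivial : ∀ z, φ z ≠ 0
  inDomain : ∀ z, InDomainNearBot a b u (φ z)

/-- `ℓ²(-∞, n]`, as the subspace of the sequences in `ℓ²(ℤ)` which vanish on `m > n`. -/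
def ellTwoUpTo (n : ℤ) : Submodule ℂ (lp (fun _ : ℤ => ℂ) 2) where
  carrier := {f | ∀ m, n < m → f m = 0}
  zero_mem' := by intro m _; simp
  add_mem' := by
    intro f g hf hg m hm
    simp [hf m hm, hg m hm]
  smul_mem' := by
    intro c f hf m hm
    simp [hf m hm]

/-- The transform `f̂(z) = ∑ₘ φ(z, m) f(m)`. -/
def jacobiTransform (φ : ℂ → ℤ → ℂ) (f : ℤ → ℂ) (z : ℂ) : ℂ :=
  ∑' m : ℤ, φ z m * f m

/-! ### de Branges spaces -/

/-- `F^#(z) = F(z*)*`. -/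
def sharp (F : ℂ → ℂ) (z : ℂ) : ℂ := conj (F (conj z))

/-- A de Branges (Hermite–Biehler) function: an entire function with `|E(z)| > |E(z*)|` in the open
upper half-plane. -/
def IsDeBrangesFunction (E : ℂ → ℂ) : Prop :=
  Differentiable ℂ E ∧ ∀ z : ℂ, 0 < z.im → ‖E (conj z)‖ < ‖E z‖

/-- The Hardy space `H²` of the upper half-plane. -/
def IsHardyTwo (h : ℂ → ℂ) : Prop :=
  DifferentiableOn ℂ h {z : ℂ | 0 < z.im} ∧
    ∃ C : ℝ≥0, ∀ y : ℝ, 0 < y →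
      eLpNorm (fun x : ℝ => h ((x : ℂ) + (y : ℂ) * I)) 2 volume ≤ C

theorem IsHardyTwo.aestronglyMeasurable {h : ℂ → ℂ} (hh : IsHardyTwo h) {y : ℝ} (hy : 0 < y) :
    AEStronglyMeasurable (fun x : ℝ => h ((x : ℂ) + (y : ℂ) * I)) volume := by
  have hc : ContinuousOn h {z : ℂ | 0 < z.im} := hh.1.continuousOn
  have : Continuous fun x : ℝ => h ((x : ℂ) + (y : ℂ) * I) :=
    hc.comp_continuous (by fun_prop) (by intro x; simpa using hy)
  exact this.aestronglyMeasurable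

theorem IsHardyTwo.zero : IsHardyTwo 0 :=
  ⟨differentiableOn_const 0, 0, fun y _ => by
    have : (fun x : ℝ => (0 : ℂ → ℂ) ((x : ℂ) + (y : ℂ) * I)) = 0 := rfl
    rw [this]; simp⟩

theorem IsHardyTwo.add {g h : ℂ → ℂ} (hg : IsHardyTwo g) (hh : IsHardyTwo h) :
    IsHardyTwo (g + h) := by
  obtain ⟨C, hC⟩ := hg.2
  obtain ⟨D, hD⟩ := hh.2
  refine ⟨hg.1.add hh.1, C + D, fun y hy => ?_⟩
  have := eLpNorm_add_le (hg.aestronglyMeasurable hy) (hh.aestronglyMeasurable hy)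
    (p := 2) (by norm_num)
  refine this.trans ?_
  push_cast
  exact add_le_add (hC y hy) (hD y hy)

theorem IsHardyTwo.smul {h : ℂ → ℂ} (c : ℂ) (hh : IsHardyTwo h) : IsHardyTwo (c • h) := by
  obtain ⟨C, hC⟩ := hh.2
  refine ⟨hh.1.const_smul c, ‖c‖₊ * C, fun y hy => ?_⟩
  have := eLpNorm_const_smul_le (c := c) (p := 2) (μ := volume)
    (f := fun x : ℝ => h ((x : ℂ) + (y : ℂ) * I))
  refine this.trans ?_
  push_cast
  exact mul_le_mul_right (hC y hy) _

/-- The de Branges space of `E`, as a space of functions: the entire functions `F` such that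
`∫ |F/E|² < ∞` on the real line and such that `F/E` and `F^#/E` belong to `H²` of the upper
half-plane. -/
def deBrangesSubmodule (E : ℂ → ℂ) : Submodule ℂ (ℂ → ℂ) where
  carrier := {F | Differentiable ℂ F ∧ MemLp (fun x : ℝ => F x / E x) 2 volume ∧
    IsHardyTwo (fun z => F z / E z) ∧ IsHardyTwo (fun z => sharp F z / E z)}
  zero_mem' := by
    refine ⟨differentiable_const 0, ?_, ?_, ?_⟩
    · simp
    · simpa using! IsHardyTwo.zero
    · simpa [sharp] using! IsHardyTwo.zero
  add_mem' := by
    rintro F G ⟨hF1, hF2, hF3, hF4⟩ ⟨hG1, hG2, hG3, hG4⟩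
    refine ⟨hF1.add hG1, ?_, ?_, ?_⟩
    · convert hF2.add hG2 using 1
      ext x; simp [add_div]
    · convert hF3.add hG3 using 1
      ext x; simp [add_div]
    · convert hF4.add hG4 using 1
      ext x; simp [sharp, add_div]
  smul_mem' := by
    rintro c F ⟨hF1, hF2, hF3, hF4⟩
    refine ⟨hF1.const_smul c, ?_, ?_, ?_⟩
    · convert hF2.const_smul c using 1
      ext x; simp [mul_div_assoc]
    · convert hF3.smul c using 1
      ext x; simp [mul_div_assoc]
    · convert hF4.smul (conj c) using 1
      ext x; simp [sharp, mul_div_assoc]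

/-- The de Branges space of `E` as a type of its own, to carry the inner product
`⟨F, G⟩ = (1/π) ∫ F(λ)* G(λ) / |E(λ)|² dλ` and its topology. -/
def DeBrangesSpace (E : ℂ → ℂ) : Type := deBrangesSubmodule E

namespace DeBrangesSpace

variable {E : ℂ → ℂ}

instance : AddCommGroup (DeBrangesSpace E) :=
  inferInstanceAs (AddCommGroup (deBrangesSubmodule E))

instance : Module ℂ (DeBrangesSpace E) :=
  inferInstanceAs (Module ℂ (deBrangesSubmodule E))

/-- The entire function underlying an element of the de Branges space. -/
def toFun (F : DeBrangesSpace E) : ℂ → ℂ := Subtype.val F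

theorem toFun_add (F G : DeBrangesSpace E) : (F + G).toFun = F.toFun + G.toFun := rfl

theorem toFun_smul (c : ℂ) (F : DeBrangesSpace E) : (c • F).toFun = c • F.toFun := rfl

theorem toFun_mem (F : DeBrangesSpace E) : F.toFun ∈ deBrangesSubmodule E := Subtype.property F

theorem integrable_inner (F G : DeBrangesSpace E) :
    Integrable (fun x : ℝ => conj (F.toFun x) * G.toFun x / ((‖E x‖ ^ 2 : ℝ) : ℂ)) := by
  have h := (G.toFun_mem.2.1).mul (r := 1) (F.toFun_mem.2.1).star
  rw [memLp_one_iff_integrable] at h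
  convert h using 1
  ext x
  have : (((‖E x‖ ^ 2 : ℝ) : ℝ) : ℂ) = conj (E x) * E x := by
    rw [conj_mul']; push_cast; rfl
  rw [this, mul_div_mul_comm]
  simp

/-- The inner product `⟨F, G⟩ = (1/π) ∫ F(λ)* G(λ) / |E(λ)|² dλ` (an absolutely convergent
integral). -/
@[reducible]
def innerCore : PreInnerProductSpace.Core ℂ (DeBrangesSpace E) where
  inner F G := ((1 / Real.pi : ℝ) : ℂ) *
    ∫ x : ℝ, conj (F.toFun x) * G.toFun x / ((‖E x‖ ^ 2 : ℝ) : ℂ)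
  conj_inner_symm F G := by
    rw [map_mul, conj_ofReal, ← integral_conj]
    congr 2
    ext x
    rw [map_div₀, map_mul, conj_ofReal, conj_conj, mul_comm]
  re_inner_nonneg F := by
    have : (fun x : ℝ => conj (F.toFun x) * F.toFun x / ((‖E x‖ ^ 2 : ℝ) : ℂ)) =
        fun x : ℝ => ((‖F.toFun x‖ ^ 2 / ‖E x‖ ^ 2 : ℝ) : ℂ) := by
      ext x
      rw [conj_mul']; push_cast; rfl
    rw [this, integral_complex_ofReal, ← ofReal_mul]
    change 0 ≤ (((1 / Real.pi) * ∫ x : ℝ, ‖F.toFun x‖ ^ 2 / ‖E x‖ ^ 2 : ℝ) : ℂ).re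
    rw [ofReal_re]
    exact mul_nonneg (by positivity) (integral_nonneg fun x => by positivity)
  add_left F G K := by
    rw [← mul_add, ← integral_add (integrable_inner F K) (integrable_inner G K)]
    congr 2
    ext x
    simp only [toFun_add, Pi.add_apply, map_add]
    ring
  smul_left F G c := by
    have : (fun x : ℝ => conj ((c • F).toFun x) * G.toFun x / ((‖E x‖ ^ 2 : ℝ) : ℂ)) =
        fun x : ℝ => conj c * (conj (F.toFun x) * G.toFun x / ((‖E x‖ ^ 2 : ℝ) : ℂ)) := by
      ext x
      simp only [toFun_smul, Pi.smul_apply, smul_eq_mul, map_mul]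
      ring
    rw [this, integral_const_mul, mul_left_comm]

/-- The seminorm and topology of the de Branges space, coming from the inner product.  For a de
Branges function `E` the seminorm is a norm: `E` then has only isolated zeros. -/
instance : SeminormedAddCommGroup (DeBrangesSpace E) :=
  @InnerProductSpace.Core.toSeminormedAddCommGroup ℂ (DeBrangesSpace E) _ _ _ innerCore

instance : InnerProductSpace ℂ (DeBrangesSpace E) :=
  InnerProductSpace.ofCore innerCore

theorem inner_def (F G : DeBrangesSpace E) :
    inner ℂ F G = ((1 / Real.pi : ℝ) : ℂ) *
      ∫ x : ℝ, conj (F.toFun x) * G.toFun x / ((‖E x‖ ^ 2 : ℝ) : ℂ) := rfl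

end DeBrangesSpace

/-- The de Branges function `E(z, n) = φ(z, n) - i a(n) φ(z, n+1)` attached to the solution `φ`.
With `τ f(n) = a(n) f(n+1) + a(n-1) f(n-1) + b(n) f(n)` the sign `-i` is the one for which
`|E(z, n)| > |E(z*, n)|` in the upper half-plane. -/
def jacobiE (a : ℤ → ℝ) (φ : ℂ → ℤ → ℂ) (n : ℤ) (z : ℂ) : ℂ :=
  φ z n - I * a n * φ z (n + 1)

end

/-!
The theorem is a statement about reproducing kernels. By the boundary condition, the Wronskian
`W(φ(w), φ(z))` tends to zero at `-∞` (`tendsto_jacobiWronskian_zero`), so the Christoffel–Darboux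
formula reads `(z - w*) ∑_{m ≤ n} φ(w, m)* φ(z, m) = W(φ(w*), φ(z))(n)`. Expressed through
`E = φ(·, n) - i a(n) φ(·, n + 1)`, the right-hand side says that the functions `φ(·, m)`, `m ≤ n`,
expand the reproducing kernel `K` of the de Branges space of `E`
(`IsRealEntireSolution.isKernelExpansion`). On the diagonal it is
`|E(z)|² - |E(z*)|² = 4 Im z ∑_{m ≤ n} |φ(z, m)|²`, which makes `E` a de Branges function.

Three facts then give the unitarity of the transform `T f = ∑ₘ φ(·, m) f(m)`.

* `T` is a contraction of `ℓ²` into the de Branges space. On a horizontal line the functions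
  `φ(·, m) / E` have the Gram kernel `(1 - θ(x) θ(t)*) / (4 y + 2 i (t - x))`. The kernel
  `1 / (4 y + 2 i (t - x))` is positive, being a Laplace transform of positive kernels, and it is
  bounded by `π`, since adding its complex conjugate yields a Poisson kernel
  (`cauchyForm_re_nonneg`, `cauchyForm_re_le`). The bound for `T` is obtained by duality on every
  line `Im z = y > 0`, uniformly in `y`, and passes to the real line by Fatou's lemma.
* `K` reproduces: `⟨K_w, F⟩ = F(w)` for `Im w > 0` and every `F` in the space
  (`deBranges_reproducing`). This is Cauchy's formula in the Hardy space, applied to `F / E` and to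
  `F^# / E`. As `K_w` is the transform of `k_w = (φ(w, m)*)ₘ`, and `(T f)(w) = ⟨k_w, f⟩`, it follows
  that `T T* F = F` (`IsKernelExpansion.exists_adjoint`), so `T` is onto.
* `T` is injective on `ℓ²(-∞, n]` (`IsRealEntireSolution.transform_injective`). A linear relation
  with last index `m` would put `φ(·, m)`, hence also `E(·, m - 1)`, into the de Branges space of
  `E(·, m - 1)`; but `1` is not in `L²(ℝ)`.

An injective `T` with `T T* = 1` has `T* T = 1`, hence is isometric.
-/

noncomputable section

/-! ### Poisson-type integrals -/

theorem integrable_inv_sub_sq_add_sq {a : ℝ} (ha : 0 < a) (x : ℝ) :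
    Integrable fun t : ℝ => ((t - x) ^ 2 + a ^ 2)⁻¹ := by
  have h := ((integrable_inv_one_add_sq.comp_div ha.ne').comp_sub_right x).const_mul (a ^ 2)⁻¹
  refine h.congr (Eventually.of_forall fun t => ?_)
  have : (t - x) ^ 2 + a ^ 2 ≠ 0 := by positivity
  have : 1 + ((t - x) / a) ^ 2 ≠ 0 := by positivity
  simp only []
  field_simp
  ring

theorem integral_inv_sub_sq_add_sq {a : ℝ} (ha : 0 < a) (x : ℝ) :
    ∫ t : ℝ, ((t - x) ^ 2 + a ^ 2)⁻¹ = Real.pi / a := by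
  have h : ∀ t : ℝ, ((t - x) ^ 2 + a ^ 2)⁻¹ = (a ^ 2)⁻¹ * (1 + ((t - x) / a) ^ 2)⁻¹ := by
    intro t
    have : (t - x) ^ 2 + a ^ 2 ≠ 0 := by positivity
    have : 1 + ((t - x) / a) ^ 2 ≠ 0 := by positivity
    field_simp
    ring
  simp_rw [h]
  rw [integral_const_mul, integral_sub_right_eq_self (fun t => (1 + (t / a) ^ 2)⁻¹) x,
    Measure.integral_comp_div (fun t : ℝ => (1 + t ^ 2)⁻¹) a, integral_univ_inv_one_add_sq,
    abs_of_pos ha, smul_eq_mul]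
  field_simp

/-! ### Cauchy's theorem for the upper half-plane -/

theorem exists_gt_lt_of_integrable {g : ℝ → ℝ} (hg : Integrable g) {ε : ℝ} (hε : 0 < ε) (X : ℝ) :
    ∃ x, X < x ∧ g x < ε := by
  by_contra! h
  have h1 : IntegrableOn (fun _ : ℝ => ε) (Set.Ioi X) := by
    refine (hg.integrableOn (s := Set.Ioi X)).mono' aestronglyMeasurable_const ?_
    filter_upwards [ae_restrict_mem measurableSet_Ioi] with x hx
    rw [Real.norm_of_nonneg hε.le]
    exact h x hx
  rw [integrableOn_const_iff] at h1
  simp [hε.ne'] at h1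

/-- If `H` is square integrable along all horizontal lines, uniformly, then it is square integrable
over the strip `0 < Im z < Y`; its square integral over vertical segments is therefore integrable
in the real part. -/
theorem integrable_vertical_sq {H : ℂ → ℂ} {C : ℝ} (hHc : ContinuousOn H {z | 0 ≤ z.im})
    (hH : ∀ y : ℝ, 0 < y → Integrable (fun x : ℝ => ‖H (x + y * I)‖ ^ 2) ∧
      ∫ x : ℝ, ‖H (x + y * I)‖ ^ 2 ≤ C) {Y : ℝ} (hY : 0 ≤ Y) :
    Integrable fun x : ℝ => ∫ y in (0 : ℝ)..Y, ‖H (x + y * I)‖ ^ 2 := by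
  set G : ℝ × ℝ → ℝ := fun p => ‖H (p.1 + (max p.2 0 : ℝ) * I)‖ ^ 2 with hG
  have hGc : Continuous G := by
    have : Continuous fun p : ℝ × ℝ => H (p.1 + (max p.2 0 : ℝ) * I) :=
      hHc.comp_continuous (by fun_prop) (by intro p; simp)
    exact this.norm.pow 2
  have hmax : ∀ y ∈ Set.Ioc 0 Y, max y 0 = y := fun y hy => max_eq_left hy.1.le
  have hGi : Integrable G (volume.prod (volume.restrict (Set.Ioc 0 Y))) := by
    rw [integrable_prod_iff' hGc.aestronglyMeasurable]
    constructor
    · filter_upwards [ae_restrict_mem measurableSet_Ioc] with y hy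
      simpa only [hG, hmax y hy] using (hH y hy.1).1
    · refine Integrable.mono' (integrable_const C)
        hGc.aestronglyMeasurable.norm.prod_swap.integral_prod_right' ?_
      filter_upwards [ae_restrict_mem measurableSet_Ioc] with y hy
      rw [Real.norm_of_nonneg (integral_nonneg fun x => norm_nonneg _)]
      simpa only [hG, hmax y hy, norm_pow, norm_norm] using (hH y hy.1).2
  refine hGi.integral_prod_left.congr (Eventually.of_forall fun x => ?_)
  simp only []
  rw [intervalIntegral.integral_of_le hY]
  refine setIntegral_congr_fun measurableSet_Ioc fun y hy => ?_
  simp only [hG, hmax y hy]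

/-- Vertical sides of a rectangle: a function dominated by `‖H z‖ / ‖z‖` has a small integral
over a vertical segment on which `H` has small square integral. -/
theorem norm_integral_vertical_le {q H : ℂ → ℂ} {R₀ : ℝ}
    (hHc : ContinuousOn H {z | 0 ≤ z.im})
    (hqH : ∀ z : ℂ, 0 ≤ z.im → R₀ ≤ ‖z‖ → ‖q z‖ * ‖z‖ ≤ ‖H z‖) {Y ε x : ℝ} (hY : 0 ≤ Y)
    (hε : 0 < ε) (hx1 : 1 ≤ |x|) (hxR : R₀ ≤ |x|) (hxY : Y / ε ≤ |x|)
    (hs : ∫ y in (0 : ℝ)..Y, ‖H (x + y * I)‖ ^ 2 < ε) :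
    ‖∫ y in (0 : ℝ)..Y, q (x + y * I)‖ ≤ ε := by
  have hc : ContinuousOn (fun y : ℝ => H (x + y * I)) (Set.uIcc 0 Y) := by
    refine hHc.comp (by fun_prop) fun y hy => ?_
    rw [Set.uIcc_of_le hY] at hy
    simpa using hy.1
  have hi : IntervalIntegrable (fun y : ℝ => ‖H (x + y * I)‖ ^ 2) volume 0 Y :=
    (hc.norm.pow 2).intervalIntegrable
  have hb : ∀ y ∈ Set.Ioc 0 Y, ‖q (x + y * I)‖ ≤ (‖H (x + y * I)‖ ^ 2 + (|x| ^ 2)⁻¹) / 2 := by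
    intro y hy
    have him : 0 ≤ ((x : ℂ) + y * I).im := by simpa using hy.1.le
    have hre : |x| ≤ ‖(x : ℂ) + y * I‖ := by
      simpa using abs_re_le_norm ((x : ℂ) + y * I)
    have h1 := hqH _ him (hxR.trans hre)
    have h2 : ‖q (x + y * I)‖ * |x| ≤ ‖H (x + y * I)‖ :=
      (mul_le_mul_of_nonneg_left hre (norm_nonneg _)).trans h1
    have hx0 : 0 < |x| := by linarith
    have h3 : ‖q (x + y * I)‖ ≤ ‖H (x + y * I)‖ * |x|⁻¹ := by
      rwa [← div_eq_mul_inv, le_div_iff₀ hx0]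
    have h4 := two_mul_le_add_sq ‖H (x + y * I)‖ |x|⁻¹
    rw [inv_pow] at h4
    linarith
  have h := intervalIntegral.norm_integral_le_of_norm_le hY
    (Eventually.of_forall hb) ((hi.add intervalIntegrable_const).div_const 2)
  refine h.trans ?_
  rw [intervalIntegral.integral_div, intervalIntegral.integral_add hi intervalIntegrable_const,
    intervalIntegral.integral_const, sub_zero, smul_eq_mul]
  have h5 : Y * (|x| ^ 2)⁻¹ ≤ ε := by
    rw [← div_eq_mul_inv, div_le_iff₀ (by positivity)]
    rw [div_le_iff₀ hε] at hxY
    nlinarith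
  linarith

/-- Top side of a rectangle at height `s ^ 2`. -/
theorem norm_integral_horizontal_le {q H : ℂ → ℂ} {R₀ C : ℝ}
    (hH : ∀ y : ℝ, 0 < y → Integrable (fun x : ℝ => ‖H (x + y * I)‖ ^ 2) ∧
      ∫ x : ℝ, ‖H (x + y * I)‖ ^ 2 ≤ C)
    (hqH : ∀ z : ℂ, 0 ≤ z.im → R₀ ≤ ‖z‖ → ‖q z‖ * ‖z‖ ≤ ‖H z‖) {s a b : ℝ} (hs : 0 < s)
    (hsR : R₀ ≤ s ^ 2) (hab : a ≤ b) :
    ‖∫ x in a..b, q (x + (s ^ 2 : ℝ) * I)‖ ≤ (C + Real.pi) / s := by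
  have hs2 : 0 < s ^ 2 := by positivity
  obtain ⟨hHi, hHC⟩ := hH (s ^ 2) hs2
  have hP := integrable_inv_sub_sq_add_sq hs2 0
  have hPi := integral_inv_sub_sq_add_sq hs2 0
  have hb : ∀ x : ℝ, ‖q (x + (s ^ 2 : ℝ) * I)‖ ≤
      ‖H (x + (s ^ 2 : ℝ) * I)‖ ^ 2 / s + s * ((x - 0) ^ 2 + (s ^ 2) ^ 2)⁻¹ := by
    intro x
    set z : ℂ := x + (s ^ 2 : ℝ) * I with hz
    have him : z.im = s ^ 2 := by rw [hz]; simp [-ofReal_pow]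
    have hre : z.re = x := by rw [hz]; simp [-ofReal_pow]
    have hn : ‖z‖ ^ 2 = (x - 0) ^ 2 + (s ^ 2) ^ 2 := by
      rw [← normSq_eq_norm_sq, normSq_apply, him, hre]; ring
    have hzs : s ^ 2 ≤ ‖z‖ := by
      have := abs_im_le_norm z
      rwa [him, abs_of_pos hs2] at this
    have hz0 : 0 < ‖z‖ := hs2.trans_le hzs
    have h1 := hqH z (by rw [him]; exact hs2.le) (hsR.trans hzs)
    rw [← hn]
    have h2 : ‖q z‖ ≤ ‖H z‖ * ‖z‖⁻¹ := by
      rwa [← div_eq_mul_inv, le_div_iff₀ hz0]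
    have h3 : 0 ≤ (‖H z‖ - s * ‖z‖⁻¹) ^ 2 / s := by positivity
    have h4 : (‖H z‖ - s * ‖z‖⁻¹) ^ 2 / s =
        ‖H z‖ ^ 2 / s + s * (‖z‖ ^ 2)⁻¹ - 2 * (‖H z‖ * ‖z‖⁻¹) := by
      field_simp
      ring
    have h5 : 0 ≤ ‖H z‖ * ‖z‖⁻¹ := by positivity
    linarith
  have hint : Integrable fun x : ℝ => ‖H (x + (s ^ 2 : ℝ) * I)‖ ^ 2 / s +
      s * ((x - 0) ^ 2 + (s ^ 2) ^ 2)⁻¹ := (hHi.div_const s).add (hP.const_mul s)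
  have h := intervalIntegral.norm_integral_le_of_norm_le hab
    (Eventually.of_forall fun x _ => hb x) hint.intervalIntegrable
  refine h.trans ?_
  rw [intervalIntegral.integral_of_le hab]
  refine (setIntegral_le_integral hint (Eventually.of_forall fun x => ?_)).trans ?_
  · simp only [Pi.zero_apply]
    positivity
  rw [integral_add (hHi.div_const s) (hP.const_mul s), integral_div, integral_const_mul, hPi,
    add_div]
  have : s * (Real.pi / s ^ 2) = Real.pi / s := by field_simp
  rw [this]
  gcongr

/-- Cauchy's theorem in the closed upper half-plane, for functions which are at infinity the product
of `1/z` and of a function bounded in `L²` along horizontal lines. The two vertical sides of the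
rectangle are placed where `H` has small square integral. -/
theorem integral_eq_zero_of_hardy_decay {q H : ℂ → ℂ} {R₀ C : ℝ}
    (hq : ∀ z : ℂ, 0 ≤ z.im → DifferentiableAt ℂ q z) (hHc : ContinuousOn H {z | 0 ≤ z.im})
    (hH : ∀ y : ℝ, 0 < y → Integrable (fun x : ℝ => ‖H (x + y * I)‖ ^ 2) ∧
      ∫ x : ℝ, ‖H (x + y * I)‖ ^ 2 ≤ C)
    (hqH : ∀ z : ℂ, 0 ≤ z.im → R₀ ≤ ‖z‖ → ‖q z‖ * ‖z‖ ≤ ‖H z‖)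
    (hint : Integrable fun x : ℝ => q x) : ∫ x : ℝ, q x = 0 := by
  have hC : 0 ≤ C := (integral_nonneg fun x => by positivity).trans (hH 1 one_pos).2
  rw [← norm_le_zero_iff]
  refine le_of_forall_pos_le_add fun δ hδ => ?_
  set ε := δ / 4 with hε'
  have hε : 0 < ε := by positivity
  -- the height `s ^ 2`, for which the top side contributes at most `ε`
  obtain ⟨s, hs, hsR, hsε⟩ : ∃ s : ℝ, 0 < s ∧ R₀ ≤ s ^ 2 ∧ (C + Real.pi) / s ≤ ε := by
    refine ⟨max (max 1 R₀) ((C + Real.pi) / ε), by positivity, ?_, ?_⟩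
    · have h1 : 1 ≤ max (max 1 R₀) ((C + Real.pi) / ε) := le_max_of_le_left (le_max_left _ _)
      have h2 : R₀ ≤ max (max 1 R₀) ((C + Real.pi) / ε) := le_max_of_le_left (le_max_right _ _)
      nlinarith
    · rw [div_le_iff₀ (by positivity), mul_comm, ← div_le_iff₀ hε]
      exact le_max_right _ _
  set Y := s ^ 2 with hYdef
  have hY : 0 < Y := by positivity
  -- the abscissas `a` and `b`, beyond the tails of the integral and where `H` is small
  have hlim : ∀ᶠ p : ℝ × ℝ in atBot ×ˢ atTop,
      ‖(∫ x in p.1..p.2, q x) - ∫ x : ℝ, q x‖ < ε := by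
    have := intervalIntegral_tendsto_integral hint (a := Prod.fst) (b := Prod.snd)
      (l := (atBot ×ˢ atTop : Filter (ℝ × ℝ))) tendsto_fst tendsto_snd
    simpa [dist_eq_norm] using (Metric.tendsto_nhds.1 this) ε hε
  obtain ⟨p, hp, r, hr, hpr⟩ := eventually_prod_iff.1 hlim
  obtain ⟨X1, hX1⟩ := eventually_atBot.1 hp
  obtain ⟨X2, hX2⟩ := eventually_atTop.1 hr
  set X := max (max 1 R₀) (max (Y / ε) (max (-X1) X2)) with hX
  have hgi := integrable_vertical_sq hHc hH hY.le
  obtain ⟨b, hb, hgb⟩ := exists_gt_lt_of_integrable hgi hε X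
  obtain ⟨a', ha', hga⟩ := exists_gt_lt_of_integrable hgi.comp_neg hε X
  set a := -a' with ha
  have hXs : 1 ≤ X ∧ R₀ ≤ X ∧ Y / ε ≤ X ∧ -X1 ≤ X ∧ X2 ≤ X := by simp [hX]
  obtain ⟨hX_1, hX_2, hX_3, hX_4, hX_5⟩ := hXs
  have habs : |b| = b := abs_of_pos (by linarith)
  have habsa : |a| = a' := by rw [ha, abs_neg, abs_of_pos (by linarith)]
  have hab : a ≤ b := by linarith
  have hright := norm_integral_vertical_le hHc hqH hY.le hε (x := b) (by rw [habs]; linarith)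
    (by rw [habs]; linarith) (by rw [habs]; linarith) hgb
  have hleft := norm_integral_vertical_le hHc hqH hY.le hε (x := a) (by rw [habsa]; linarith)
    (by rw [habsa]; linarith) (by rw [habsa]; linarith) hga
  have htop := (norm_integral_horizontal_le hH hqH hs hsR hab).trans hsε
  have hbot := hpr (hX1 a (by linarith)) (hX2 b (by linarith))
  have hrect := integral_boundary_rect_eq_zero_of_differentiableOn q a (b + Y * I) (by
    intro z hz
    refine (hq z ?_).differentiableWithinAt
    have := hz.2
    simp only [Set.mem_preimage] at this
    rw [Set.uIcc_of_le (by simpa using hY.le)] at this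
    simpa using this.1)
  simp only [ofReal_re, ofReal_im, add_re, mul_re, I_re, mul_zero, I_im, mul_one, sub_self,
    add_zero, add_im, mul_im, zero_add, ofReal_zero, zero_mul, smul_eq_mul] at hrect
  set Jb := ∫ x in a..b, q x
  set Jt := ∫ x in a..b, q (x + Y * I)
  set Jr := ∫ y in (0 : ℝ)..Y, q (b + y * I)
  set Jl := ∫ y in (0 : ℝ)..Y, q (a + y * I)
  set J := ∫ x : ℝ, q x
  have hJ : J = -(Jb - J) + Jt - I * Jr + I * Jl := by linear_combination hrect
  rw [hJ]
  calc ‖-(Jb - J) + Jt - I * Jr + I * Jl‖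
      ≤ ‖-(Jb - J)‖ + ‖Jt‖ + ‖I * Jr‖ + ‖I * Jl‖ :=
        (norm_add_le _ _).trans (add_le_add_left ((norm_sub_le _ _).trans
          (add_le_add_left (norm_add_le _ _) _)) _)
    _ ≤ ε + ε + ε + ε := by
        rw [norm_neg, norm_mul, norm_mul, norm_I, one_mul, one_mul]
        gcongr
    _ = 0 + δ := by rw [hε']; ring

/-! ### Cauchy's formulas for the Hardy space -/

theorem memLp_two_of_eLpNorm_le {α : Type*} [MeasurableSpace α] {μ : Measure α} {f : α → ℂ}
    (hf : AEStronglyMeasurable f μ) {C : ℝ≥0} (h : eLpNorm f 2 μ ≤ C) :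
    Integrable (fun x => ‖f x‖ ^ 2) μ ∧ ∫ x, ‖f x‖ ^ 2 ∂μ ≤ (C : ℝ) ^ 2 := by
  have hm : MemLp f 2 μ := ⟨hf, h.trans_lt ENNReal.coe_lt_top⟩
  refine ⟨hm.integrable_norm_pow two_ne_zero, ?_⟩
  have h0 : 0 ≤ ∫ x, ‖f x‖ ^ 2 ∂μ := integral_nonneg fun x => by positivity
  rw [hm.eLpNorm_eq_integral_rpow_norm two_ne_zero ENNReal.ofNat_ne_top] at h
  have h' := ENNReal.toReal_mono ENNReal.coe_ne_top h
  simp only [ENNReal.toReal_ofNat, Real.rpow_two] at h'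
  rw [ENNReal.toReal_ofReal (by positivity), ENNReal.coe_toReal] at h'
  rw [show (2 : ℝ)⁻¹ = 1 / 2 by norm_num, ← Real.sqrt_eq_rpow] at h'
  exact (Real.sqrt_le_left C.2).1 h'

theorem eLpNorm_two_le_of_integral_le {α : Type*} [MeasurableSpace α] {μ : Measure α} {f : α → ℂ}
    (hf : AEStronglyMeasurable f μ) (hi : Integrable (fun x => ‖f x‖ ^ 2) μ) {C : ℝ≥0}
    (h : ∫ x, ‖f x‖ ^ 2 ∂μ ≤ (C : ℝ) ^ 2) : eLpNorm f 2 μ ≤ C := by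
  have hm : MemLp f 2 μ := (memLp_two_iff_integrable_sq_norm hf).2 hi
  rw [hm.eLpNorm_eq_integral_rpow_norm two_ne_zero ENNReal.ofNat_ne_top]
  simp only [ENNReal.toReal_ofNat, Real.rpow_two]
  rw [show (2 : ℝ)⁻¹ = 1 / 2 by norm_num, ← Real.sqrt_eq_rpow]
  rw [ENNReal.ofReal_le_iff_le_toReal ENNReal.coe_ne_top, ENNReal.coe_toReal]
  exact (Real.sqrt_le_left C.2).2 h

theorem sub_conj_ne_zero {w z : ℂ} (hw : 0 < w.im) (hz : 0 ≤ z.im) : z - conj w ≠ 0 := by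
  intro h
  have := congrArg Complex.im h
  simp at this
  linarith

theorem differentiableAt_inv_sub_conj {w z : ℂ} (hw : 0 < w.im) (hz : 0 ≤ z.im) :
    DifferentiableAt ℂ (fun z => (z - conj w)⁻¹) z :=
  (differentiableAt_id.sub_const (conj w)).fun_inv (sub_conj_ne_zero hw hz)

theorem norm_sub_conj_sq (x y : ℝ) (w : ℂ) :
    ‖(x : ℂ) + y * I - conj w‖ ^ 2 = (x - w.re) ^ 2 + (y + w.im) ^ 2 := by
  rw [← normSq_eq_norm_sq, normSq_apply]
  simp
  ring

/-- The Cauchy kernel with pole in the lower half-plane belongs to `H²`. -/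
theorem isHardyTwo_inv_sub_conj {w : ℂ} (hw : 0 < w.im) :
    IsHardyTwo fun z => (z - conj w)⁻¹ := by
  refine ⟨fun z hz => ?_, (√(Real.pi / w.im)).toNNReal, fun y hy => ?_⟩
  · exact (differentiableAt_inv_sub_conj hw (le_of_lt hz)).differentiableWithinAt
  · have hyw : 0 < y + w.im := by positivity
    have hn : ∀ x : ℝ, ‖((x : ℂ) + y * I - conj w)⁻¹‖ ^ 2 =
        ((x - w.re) ^ 2 + (y + w.im) ^ 2)⁻¹ := by
      intro x
      rw [norm_inv, inv_pow, norm_sub_conj_sq]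
    refine eLpNorm_two_le_of_integral_le ?_ ?_ ?_
    · refine Continuous.aestronglyMeasurable (Continuous.inv₀ (by fun_prop) fun x => ?_)
      exact sub_conj_ne_zero hw (by simpa using hy.le)
    · simp_rw [hn]
      exact integrable_inv_sub_sq_add_sq hyw _
    · simp_rw [hn]
      rw [integral_inv_sub_sq_add_sq hyw, Real.coe_toNNReal _ (Real.sqrt_nonneg _),
        Real.sq_sqrt (by positivity)]
      have := Real.pi_pos
      gcongr
      linarith

theorem memLp_inv_sub {w : ℂ} (hw : w.im ≠ 0) :
    MemLp (fun x : ℝ => ((x : ℂ) - w)⁻¹) 2 := by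
  have h0 : ∀ x : ℝ, (x : ℂ) - w ≠ 0 := by
    intro x h
    have := congrArg Complex.im h
    simp at this
    exact hw this
  have hc : Continuous fun x : ℝ => ((x : ℂ) - w)⁻¹ := Continuous.inv₀ (by fun_prop) h0
  rw [memLp_two_iff_integrable_sq_norm hc.aestronglyMeasurable]
  have := integrable_inv_sub_sq_add_sq (abs_pos.2 hw) w.re
  refine this.congr (Eventually.of_forall fun x => ?_)
  simp only []
  rw [norm_inv, inv_pow, ← normSq_eq_norm_sq, normSq_apply, sq_abs]
  simp
  ring

theorem IsHardyTwo.exists_integral_sq_le {h : ℂ → ℂ} (hh : IsHardyTwo h) :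
    ∃ C : ℝ, ∀ y : ℝ, 0 < y → Integrable (fun x : ℝ => ‖h (x + y * I)‖ ^ 2) ∧
      ∫ x : ℝ, ‖h (x + y * I)‖ ^ 2 ≤ C := by
  obtain ⟨C, hC⟩ := hh.2
  exact ⟨(C : ℝ) ^ 2, fun y hy => memLp_two_of_eLpNorm_le (hh.aestronglyMeasurable hy) (hC y hy)⟩

theorem integrable_div_sub {h : ℝ → ℂ} (hh : MemLp h 2) {w : ℂ} (hw : w.im ≠ 0) :
    Integrable fun x : ℝ => h x / (x - w) := by
  have := hh.mul (r := 1) (memLp_inv_sub hw)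
  rw [memLp_one_iff_integrable] at this
  refine this.congr (Eventually.of_forall fun x => ?_)
  simp [div_eq_inv_mul]

theorem norm_div_two_le_norm_sub {z w : ℂ} (h : 2 * ‖w‖ ≤ ‖z‖) : ‖z‖ / 2 ≤ ‖z - w‖ := by
  have := norm_sub_norm_le z w
  linarith

/-- Cauchy's theorem in `H²`: the kernel has its pole in the lower half-plane. -/
theorem IsHardyTwo.integral_div_sub_conj {h : ℂ → ℂ} (hh : IsHardyTwo h)
    (hd : ∀ z : ℂ, 0 ≤ z.im → DifferentiableAt ℂ h z) (hR : MemLp (fun x : ℝ => h x) 2) {w : ℂ}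
    (hw : 0 < w.im) : ∫ x : ℝ, h x / (x - conj w) = 0 := by
  obtain ⟨C, hC⟩ := (hh.smul 2).exists_integral_sq_le
  refine integral_eq_zero_of_hardy_decay (q := fun z => h z / (z - conj w)) (R₀ := 2 * ‖w‖)
    (H := (2 : ℂ) • h) ?_ ?_ hC ?_ ?_
  · intro z hz
    exact (hd z hz).div (differentiableAt_id.sub_const _) (sub_conj_ne_zero hw hz)
  · intro z hz
    exact ((hd z hz).const_smul (2 : ℂ)).continuousAt.continuousWithinAt
  · intro z hz hzw
    rw [← norm_conj w] at hzw
    have h1 := norm_div_two_le_norm_sub hzw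
    have h2 : 0 < ‖z - conj w‖ := norm_pos_iff.2 (sub_conj_ne_zero hw hz)
    rw [norm_div, div_mul_eq_mul_div, div_le_iff₀ h2, Pi.smul_apply, norm_smul]
    norm_num
    nlinarith [norm_nonneg (h z)]
  · exact integrable_div_sub hR (by simpa using hw.ne')

/-- Cauchy's formula in `H²`. The numerator `h - h(w) (w - w*) / (· - w*)` vanishes at `w`, which
removes the pole without leaving `H²`. -/
theorem IsHardyTwo.integral_div_sub {h : ℂ → ℂ} (hh : IsHardyTwo h)
    (hd : ∀ z : ℂ, 0 ≤ z.im → DifferentiableAt ℂ h z) (hR : MemLp (fun x : ℝ => h x) 2) {w : ℂ}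
    (hw : 0 < w.im) : ∫ x : ℝ, h x / (x - w) = 2 * Real.pi * I * h w := by
  set c : ℂ := -(h w * (w - conj w)) with hc
  set g : ℂ → ℂ := h + c • fun z => (z - conj w)⁻¹ with hg
  have hgH : IsHardyTwo g := hh.add ((isHardyTwo_inv_sub_conj hw).smul c)
  have hww := sub_conj_ne_zero hw hw.le
  have hgw : g w = 0 := by
    simp only [hg, Pi.add_apply, Pi.smul_apply, smul_eq_mul, hc]
    field_simp
    ring
  have hgd : ∀ z : ℂ, 0 ≤ z.im → DifferentiableAt ℂ g z := fun z hz =>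
    (hd z hz).add ((differentiableAt_inv_sub_conj hw hz).const_smul c)
  have hwim : (conj w).im ≠ 0 := by simpa using hw.ne'
  have hgR : MemLp (fun x : ℝ => g x) 2 := hR.add ((memLp_inv_sub hwim).const_smul c)
  have hxw : ∀ x : ℝ, (x : ℂ) - w ≠ 0 := fun x h0 => by
    have := congrArg Complex.im h0
    simp at this
    exact hw.ne' this
  have hds : ∀ z, z ≠ w → dslope g w z = g z / (z - w) := fun z hz => by
    rw [dslope_of_ne _ hz, slope_def_field, hgw, sub_zero]
  have hdsx : ∀ x : ℝ, dslope g w x = g x / (x - w) := fun x => hds _ (sub_ne_zero.1 (hxw x))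
  obtain ⟨C, hC⟩ := (hgH.smul 2).exists_integral_sq_le
  have key : ∫ x : ℝ, dslope g w x = 0 := by
    refine integral_eq_zero_of_hardy_decay (R₀ := 2 * ‖w‖) (H := (2 : ℂ) • g) ?_ ?_ hC ?_ ?_
    · intro z hz
      by_cases hzw : z = w
      · have hs : {z : ℂ | 0 < z.im} ∈ 𝓝 w :=
          (isOpen_lt continuous_const continuous_im).mem_nhds hw
        rw [hzw]
        exact ((differentiableOn_dslope hs).2 hgH.1).differentiableAt hs
      · exact (differentiableAt_dslope_of_ne hzw).2 (hgd z hz)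
    · intro z hz
      exact ((hgd z hz).const_smul (2 : ℂ)).continuousAt.continuousWithinAt
    · intro z hz hzw
      have h1 := norm_div_two_le_norm_sub hzw
      by_cases hzw' : z = w
      · have : ‖w‖ ≤ 0 := by rw [hzw'] at hzw; linarith
        have : w = 0 := norm_le_zero_iff.1 this
        simp [this] at hw
      · have h2 : 0 < ‖z - w‖ := norm_pos_iff.2 (sub_ne_zero.2 hzw')
        rw [hds z hzw', norm_div, div_mul_eq_mul_div, div_le_iff₀ h2, Pi.smul_apply, norm_smul]
        norm_num
        nlinarith [norm_nonneg (g z)]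
    · simp_rw [hdsx]
      exact integrable_div_sub hgR hw.ne'
  have hP := integrable_inv_sub_sq_add_sq hw w.re
  have hsplit : ∀ x : ℝ, h x / (x - w) =
      dslope g w x - c * ((((x - w.re) ^ 2 + w.im ^ 2)⁻¹ : ℝ) : ℂ) := by
    intro x
    have h3 : ((((x - w.re) ^ 2 + w.im ^ 2) : ℝ) : ℂ) = (x - w) * (x - conj w) := by
      have h5 := norm_sub_conj_sq x 0 w
      rw [zero_add] at h5
      rw [← h5]
      have h6 : (x : ℂ) - w = conj ((x : ℂ) - conj w) := by simp
      rw [h6, conj_mul']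
      simp
    have h4 := sub_conj_ne_zero (z := (x : ℂ)) hw (by simp)
    have h7 := hxw x
    rw [hdsx, ofReal_inv, h3]
    simp only [hg, Pi.add_apply, Pi.smul_apply, smul_eq_mul]
    field_simp
    ring
  have hint : Integrable fun x : ℝ => dslope g w x := by
    simp_rw [hdsx]
    exact integrable_div_sub hgR hw.ne'
  have hPc : Integrable fun x : ℝ => c * ((((x - w.re) ^ 2 + w.im ^ 2)⁻¹ : ℝ) : ℂ) :=
    hP.ofReal.const_mul c
  simp_rw [hsplit]
  rw [integral_sub hint hPc, key, integral_const_mul, integral_complex_ofReal,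
    integral_inv_sub_sq_add_sq hw, hc, sub_conj]
  have : (w.im : ℂ) ≠ 0 := by exact_mod_cast hw.ne'
  push_cast
  field_simp
  ring

/-! ### The reproducing formula of a de Branges space -/

theorem differentiable_sharp {F : ℂ → ℂ} (hF : Differentiable ℂ F) :
    Differentiable ℂ (sharp F) := fun z => differentiableAt_conj_conj_iff.2 (hF (conj z))

/-- The reproducing formula at points of the upper half-plane: `F(w)` is recovered from the two
Cauchy integrals of `F / E` and of `F^# / E`, of which the second vanishes. -/
theorem deBranges_reproducing {E F : ℂ → ℂ} (hE : Differentiable ℂ E)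
    (hE0 : ∀ z : ℂ, 0 ≤ z.im → E z ≠ 0) (hF : F ∈ deBrangesSubmodule E) {w : ℂ} (hw : 0 < w.im) :
    ∫ x : ℝ, (E w * conj (E x) - conj (E (conj w)) * E x) / (2 * I * (x - w)) * F x /
      ((‖E x‖ ^ 2 : ℝ) : ℂ) = Real.pi * F w := by
  obtain ⟨hFd, hF2, hF3, hF4⟩ := hF
  have hsd : Differentiable ℂ (sharp F) := differentiable_sharp hFd
  have hwim : (conj w).im ≠ 0 := by simpa using hw.ne'
  have h1 := hF3.integral_div_sub (fun z hz => (hFd z).div (hE z) (hE0 z hz)) hF2 hw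
  have hs2 : MemLp (fun x : ℝ => sharp F x / E x) 2 := by
    refine MemLp.of_le hF2 ?_ (Eventually.of_forall fun x => ?_)
    · refine Continuous.aestronglyMeasurable (Continuous.div ?_ ?_ fun x => hE0 x (by simp))
      · exact hsd.continuous.comp continuous_ofReal
      · exact hE.continuous.comp continuous_ofReal
    · simp [sharp]
  have h2 := hF4.integral_div_sub_conj (fun z hz => (hsd z).div (hE z) (hE0 z hz)) hs2 hw
  have h2' : ∫ x : ℝ, conj (sharp F x / E x / (x - conj w)) = 0 := by
    rw [integral_conj, h2, map_zero]
  have i1 := integrable_div_sub hF2 hw.ne'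
  have i2 : Integrable fun x : ℝ => conj (sharp F x / E x / (x - conj w)) := by
    have := integrable_div_sub hs2 hwim
    exact (LinearIsometryEquiv.integrable_comp_iff conjLIE).2 this
  have hsplit : ∀ x : ℝ, (E w * conj (E x) - conj (E (conj w)) * E x) / (2 * I * (x - w)) * F x /
      ((‖E x‖ ^ 2 : ℝ) : ℂ) = (E w / (2 * I)) * (F x / E x / (x - w)) -
        (conj (E (conj w)) / (2 * I)) * conj (sharp F x / E x / (x - conj w)) := by
    intro x
    have hx : E x ≠ 0 := hE0 x (by simp)
    have hx' : conj (E x) ≠ 0 := by simpa using hx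
    have hxw : (x : ℂ) - w ≠ 0 := fun h0 => by
      have := congrArg Complex.im h0
      simp at this
      exact hw.ne' this
    have : (((‖E x‖ ^ 2 : ℝ) : ℝ) : ℂ) = conj (E x) * E x := by
      rw [conj_mul']; push_cast; rfl
    rw [this]
    simp only [sharp, map_div₀, map_sub, conj_conj, conj_ofReal]
    field_simp
  simp_rw [hsplit]
  rw [integral_sub (i1.const_mul _) (i2.const_mul _), integral_const_mul, integral_const_mul, h1,
    h2', mul_zero, sub_zero]
  have := hE0 w hw.le
  have := I_ne_zero
  field_simp

/-! ### Positivity of the Cauchy kernel -/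

/-- The quadratic form of the kernel `1 / (4 y + 2 i (t - x))` on a measure on the real line. -/
def cauchyForm (μ : Measure ℝ) (y : ℝ) (g : ℝ → ℂ) : ℂ :=
  ∫ p : ℝ × ℝ, conj (g p.1) * g p.2 / (4 * y + 2 * I * (p.2 - p.1)) ∂(μ.prod μ)

theorem re_cauchyKernel_denom (y x t : ℝ) : (4 * (y : ℂ) + 2 * I * (t - x)).re = 4 * y := by
  simp

theorem norm_inv_cauchyKernel_le {y : ℝ} (hy : 0 < y) (x t : ℝ) :
    ‖(4 * (y : ℂ) + 2 * I * (t - x))⁻¹‖ ≤ (4 * y)⁻¹ := by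
  rw [norm_inv]
  have h := re_le_norm (4 * (y : ℂ) + 2 * I * (t - x))
  rw [re_cauchyKernel_denom] at h
  gcongr

theorem cauchyKernel_denom_ne_zero {y : ℝ} (hy : 0 < y) (x t : ℝ) :
    (4 * (y : ℂ) + 2 * I * (t - x)) ≠ 0 := fun h => by
  have := re_cauchyKernel_denom y x t
  rw [h] at this
  simp at this
  linarith

theorem integrable_cauchyForm {μ : Measure ℝ} [SFinite μ] {y : ℝ} (hy : 0 < y) {g h : ℝ → ℂ}
    (hg : Integrable g μ) (hh : Integrable h μ) :
    Integrable (fun p : ℝ × ℝ => g p.1 * h p.2 / (4 * y + 2 * I * (p.2 - p.1))) (μ.prod μ) := by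
  have hc : Continuous fun p : ℝ × ℝ => (4 * (y : ℂ) + 2 * I * (p.2 - p.1))⁻¹ :=
    Continuous.inv₀ (by fun_prop) fun p => cauchyKernel_denom_ne_zero hy p.1 p.2
  simp_rw [div_eq_mul_inv]
  exact (hg.mul_prod hh).mul_bdd (c := (4 * y)⁻¹) hc.aestronglyMeasurable
    (Eventually.of_forall fun p => norm_inv_cauchyKernel_le hy p.1 p.2)

theorem integrable_conj {α : Type*} [MeasurableSpace α] {μ : Measure α} {g : α → ℂ}
    (hg : Integrable g μ) : Integrable (fun x => conj (g x)) μ :=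
  (LinearIsometryEquiv.integrable_comp_iff conjLIE).2 hg

/-- The Cauchy kernel is the Laplace transform of the positive kernels
`exp (2 i s x) conj (exp (2 i s t))`, so its quadratic form is nonnegative. -/
theorem exists_cauchyForm_eq {μ : Measure ℝ} [SFinite μ] {y : ℝ} (hy : 0 < y) {g : ℝ → ℂ}
    (hg : Integrable g μ) : ∃ r : ℝ, 0 ≤ r ∧ cauchyForm μ y g = r := by
  set ν := volume.restrict (Set.Ioi (0 : ℝ)) with hν
  set G : ℝ → ℂ := fun s => ∫ t, g t * cexp (-(2 * I * t * s)) ∂μ with hG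
  have hexp : ∀ x t : ℝ, ∫ s, cexp (-(4 * y + 2 * I * (t - x)) * s) ∂ν =
      (4 * (y : ℂ) + 2 * I * (t - x))⁻¹ := by
    intro x t
    rw [hν, integral_exp_mul_complex_Ioi (by rw [neg_re, re_cauchyKernel_denom]; linarith)]
    rw [ofReal_zero, mul_zero, Complex.exp_zero, neg_div_neg_eq, one_div]
  set f : (ℝ × ℝ) → ℝ → ℂ := fun p s =>
    conj (g p.1) * g p.2 * cexp (-(4 * y + 2 * I * (p.2 - p.1)) * s) with hf
  have hfi : Integrable (Function.uncurry f) ((μ.prod μ).prod ν) := by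
    have h1 : Integrable (fun q : (ℝ × ℝ) × ℝ => (conj (g q.1.1) * g q.1.2) *
        cexp (((-(4 * y) : ℝ) : ℂ) * q.2)) ((μ.prod μ).prod ν) := by
      have h2 : Integrable (fun s : ℝ => cexp (((-(4 * y) : ℝ) : ℂ) * s)) ν :=
        integrableOn_exp_mul_complex_Ioi (by rw [ofReal_re]; linarith) 0
      exact ((integrable_conj hg).mul_prod hg).mul_prod h2
    have h3 : Continuous fun q : (ℝ × ℝ) × ℝ => cexp (-(2 * I * (q.1.2 - q.1.1)) * q.2) := by
      fun_prop
    refine (h1.mul_bdd (c := 1) h3.aestronglyMeasurable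
      (Eventually.of_forall fun q => ?_)).congr (Eventually.of_forall fun q => ?_)
    · rw [norm_exp]
      simp
    · simp only [Function.uncurry, hf]
      rw [mul_assoc, ← Complex.exp_add]
      congr 2
      push_cast
      ring
  have hswap : cauchyForm μ y g = ∫ s, ∫ p, f p s ∂(μ.prod μ) ∂ν := by
    rw [← integral_integral_swap hfi, cauchyForm]
    refine integral_congr_ae (Eventually.of_forall fun p => ?_)
    simp only [hf]
    rw [integral_const_mul, hexp, div_eq_mul_inv]
  have hin : ∀ s : ℝ, ∫ p, f p s ∂(μ.prod μ) = ((Real.exp (-(4 * y) * s) * ‖G s‖ ^ 2 : ℝ) : ℂ) := by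
    intro s
    have h1 : ∀ p : ℝ × ℝ, f p s = (Real.exp (-(4 * y) * s) : ℂ) *
        (conj (g p.1 * cexp (-(2 * I * p.1 * s))) * (g p.2 * cexp (-(2 * I * p.2 * s)))) := by
      intro p
      simp only [hf]
      rw [map_mul, ← exp_conj, ofReal_exp]
      have : conj (-(2 * I * (p.1 : ℂ) * s)) = 2 * I * p.1 * s := by
        simp only [map_neg, map_mul, conj_I, conj_ofReal, map_ofNat]
        ring
      rw [this]
      have h2 : cexp (-(4 * y + 2 * I * (p.2 - p.1)) * s) = cexp ((-(4 * y) * s : ℝ) : ℂ) *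
          cexp (2 * I * p.1 * s) * cexp (-(2 * I * p.2 * s)) := by
        rw [← Complex.exp_add, ← Complex.exp_add]
        congr 1
        push_cast
        ring
      rw [h2]
      ring
    simp_rw [h1]
    rw [integral_const_mul,
      integral_prod_mul (fun t : ℝ => conj (g t * cexp (-(2 * I * t * s))))
        (fun t : ℝ => g t * cexp (-(2 * I * t * s))), integral_conj, conj_mul']
    push_cast
    rfl
  refine ⟨∫ s, Real.exp (-(4 * y) * s) * ‖G s‖ ^ 2 ∂ν, integral_nonneg fun s => by positivity, ?_⟩
  rw [hswap]
  simp_rw [hin]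
  exact integral_complex_ofReal

theorem cauchyForm_re_nonneg {μ : Measure ℝ} [SFinite μ] {y : ℝ} (hy : 0 < y) {g : ℝ → ℂ}
    (hg : Integrable g μ) : 0 ≤ (cauchyForm μ y g).re := by
  obtain ⟨r, hr, h⟩ := exists_cauchyForm_eq hy hg
  rw [h, ofReal_re]
  exact hr

/-- Adding the form at the conjugate function turns the Cauchy kernel into the Poisson kernel. -/
theorem cauchyForm_add_conj {μ : Measure ℝ} [SFinite μ] {y : ℝ} (hy : 0 < y) {g : ℝ → ℂ}
    (hg : Integrable g μ) :
    cauchyForm μ y g + cauchyForm μ y (fun x => conj (g x)) =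
      ∫ p : ℝ × ℝ, conj (g p.1) * g p.2 *
        ((2 * y * ((p.2 - p.1) ^ 2 + (2 * y) ^ 2)⁻¹ : ℝ) : ℂ) ∂(μ.prod μ) := by
  have h1 : cauchyForm μ y (fun x => conj (g x)) =
      ∫ p : ℝ × ℝ, conj (g p.1) * g p.2 / (4 * y + 2 * I * (p.1 - p.2)) ∂(μ.prod μ) := by
    rw [cauchyForm, ← integral_prod_swap]
    refine integral_congr_ae (Eventually.of_forall fun p => ?_)
    simp only [Prod.fst_swap, Prod.snd_swap, conj_conj]
    ring
  have i1 := integrable_cauchyForm hy (integrable_conj hg) hg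
  have i2 := (integrable_cauchyForm hy hg (integrable_conj hg)).swap
  have i2' : Integrable (fun p : ℝ × ℝ => conj (g p.1) * g p.2 /
      (4 * y + 2 * I * (p.1 - p.2))) (μ.prod μ) := by
    refine i2.congr (Eventually.of_forall fun p => ?_)
    simp only [Function.comp, Prod.fst_swap, Prod.snd_swap]
    ring
  rw [h1, cauchyForm, ← integral_add i1 i2']
  refine integral_congr_ae (Eventually.of_forall fun p => ?_)
  have d1 := cauchyKernel_denom_ne_zero hy p.1 p.2
  have d2 := cauchyKernel_denom_ne_zero hy p.2 p.1
  have d3 : ((p.2 - p.1) ^ 2 + (2 * y) ^ 2 : ℝ) ≠ 0 := by positivity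
  have d3' : ((p.2 - p.1 : ℂ) ^ 2 + (2 * y) ^ 2) ≠ 0 := by exact_mod_cast d3
  have h3 : (4 * (y : ℂ) + 2 * I * (p.2 - p.1)) * (4 * y + 2 * I * (p.1 - p.2)) =
      4 * ((p.2 - p.1) ^ 2 + (2 * y) ^ 2) := by
    linear_combination (-4 * ((p.2 : ℂ) - p.1) ^ 2) * I_sq
  simp only []
  push_cast
  rw [div_add_div _ _ d1 d2, h3, div_eq_iff (mul_ne_zero (by norm_num) d3')]
  linear_combination (-8 * y * (conj (g p.1) * g p.2)) * mul_inv_cancel₀ d3'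

/-- The form is bounded by `π` times the square of the `L²` norm: it is at most the form of
the Poisson kernel, to which the Schur test applies. -/
theorem cauchyForm_re_le {μ : Measure ℝ} [SFinite μ] (hμ : μ ≤ volume) {y : ℝ} (hy : 0 < y)
    {g : ℝ → ℂ} (hg : Integrable g μ) (hg2 : Integrable (fun x => ‖g x‖ ^ 2) μ) :
    (cauchyForm μ y g).re ≤ Real.pi * ∫ x, ‖g x‖ ^ 2 ∂μ := by
  have h0 := cauchyForm_re_nonneg hy (integrable_conj hg)
  have hadd := congrArg re (cauchyForm_add_conj hy hg)
  rw [add_re] at hadd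
  set P : ℝ × ℝ → ℝ := fun p => 2 * y * ((p.2 - p.1) ^ 2 + (2 * y) ^ 2)⁻¹ with hP
  have hP0 : ∀ p, 0 ≤ P p := fun p => by positivity
  have hPc : Continuous P := by
    refine continuous_const.mul (Continuous.inv₀ (by fun_prop) fun p => ?_)
    positivity
  have h2y : 0 < 2 * y := by positivity
  have hPi : ∀ x, Integrable (fun t => P (x, t)) μ := fun x =>
    ((integrable_inv_sub_sq_add_sq h2y x).const_mul (2 * y)).mono_measure hμ
  have hPint : ∀ x, ∫ t, P (x, t) ∂μ ≤ Real.pi := fun x => by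
    refine (integral_mono_measure hμ (Eventually.of_forall fun t => hP0 (x, t))
      ((integrable_inv_sub_sq_add_sq h2y x).const_mul (2 * y))).trans ?_
    simp only [hP]
    rw [integral_const_mul, integral_inv_sub_sq_add_sq h2y]
    field_simp
    rfl
  have hsym : ∀ p : ℝ × ℝ, P p.swap = P p := fun p => by
    simp only [hP, Prod.fst_swap, Prod.snd_swap]
    rw [← neg_sq, neg_sub]
  have hJm : AEStronglyMeasurable (fun p : ℝ × ℝ => ‖g p.1‖ ^ 2 * P p) (μ.prod μ) :=
    (hg2.aestronglyMeasurable.comp_fst).mul hPc.aestronglyMeasurable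
  have hJ : Integrable (fun p : ℝ × ℝ => ‖g p.1‖ ^ 2 * P p) (μ.prod μ) := by
    rw [integrable_prod_iff hJm]
    refine ⟨Eventually.of_forall fun x => (hPi x).const_mul (‖g x‖ ^ 2), ?_⟩
    refine Integrable.mono' (hg2.mul_const Real.pi) hJm.norm.integral_prod_right' ?_
    refine Eventually.of_forall fun x => ?_
    rw [Real.norm_of_nonneg (integral_nonneg fun t => norm_nonneg _)]
    have : ∀ t, ‖‖g x‖ ^ 2 * P (x, t)‖ = ‖g x‖ ^ 2 * P (x, t) := fun t =>
      Real.norm_of_nonneg (mul_nonneg (by positivity) (hP0 _))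
    simp only [this]
    rw [integral_const_mul]
    exact mul_le_mul_of_nonneg_left (hPint x) (by positivity)
  have hJle : ∫ p, ‖g p.1‖ ^ 2 * P p ∂(μ.prod μ) ≤ Real.pi * ∫ x, ‖g x‖ ^ 2 ∂μ := by
    rw [integral_prod _ hJ, ← integral_const_mul]
    refine integral_mono hJ.integral_prod_left (hg2.const_mul _) fun x => ?_
    simp only []
    rw [integral_const_mul, mul_comm]
    exact mul_le_mul_of_nonneg_right (hPint x) (by positivity)
  have hJ' : Integrable (fun p : ℝ × ℝ => ‖g p.2‖ ^ 2 * P p) (μ.prod μ) := by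
    refine hJ.swap.congr (Eventually.of_forall fun p => ?_)
    simp only [Function.comp, hsym, Prod.fst_swap]
  have hJJ' : ∫ p, ‖g p.2‖ ^ 2 * P p ∂(μ.prod μ) = ∫ p, ‖g p.1‖ ^ 2 * P p ∂(μ.prod μ) := by
    rw [← integral_prod_swap]
    simp only [hsym, Prod.snd_swap]
  have hle : (∫ p : ℝ × ℝ, conj (g p.1) * g p.2 * ((P p : ℝ) : ℂ) ∂(μ.prod μ)).re ≤
      ∫ p, ‖g p.1‖ ^ 2 * P p ∂(μ.prod μ) := by
    refine (re_le_norm _).trans ?_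
    have h1 : ‖∫ p : ℝ × ℝ, conj (g p.1) * g p.2 * ((P p : ℝ) : ℂ) ∂(μ.prod μ)‖ ≤
        ∫ p, (‖g p.1‖ ^ 2 * P p + ‖g p.2‖ ^ 2 * P p) / 2 ∂(μ.prod μ) := by
      refine norm_integral_le_of_norm_le ((hJ.add hJ').div_const 2)
        (Eventually.of_forall fun p => ?_)
      rw [norm_mul, norm_mul, norm_conj, norm_real, Real.norm_of_nonneg (hP0 p)]
      nlinarith [mul_nonneg (sq_nonneg (‖g p.1‖ - ‖g p.2‖)) (hP0 p)]
    refine h1.trans_eq ?_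
    rw [integral_div, integral_add hJ hJ', hJJ']
    ring
  linarith

/-! ### Expansions of a de Branges kernel -/

/-- The entire functions `e m`, real on the real line, expand the reproducing kernel of the
de Branges space of `E`:
`∑ₘ e m (w)* e m (z) = (E(z) E(w)* - E^#(z) E^#(w)*) / (2 i (w* - z))`.
The function `E` is required to have no zeros in the closed upper half-plane. -/
structure IsKernelExpansion (E : ℂ → ℂ) (e : ℤ → ℂ → ℂ) : Prop where
  differentiable_E : Differentiable ℂ E
  ne_zero : ∀ z : ℂ, 0 ≤ z.im → E z ≠ 0
  differentiable : ∀ m, Differentiable ℂ (e m)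
  real : ∀ m z, e m (conj z) = conj (e m z)
  sqSummable : ∀ z, Summable fun m => ‖e m z‖ ^ 2
  kernel : ∀ w z, 2 * I * (conj w - z) * ∑' m, conj (e m w) * e m z =
    E z * conj (E w) - conj (E (conj z)) * E (conj w)

theorem four_im_mul_tsum_of_kernel {E : ℂ → ℂ} {e : ℤ → ℂ → ℂ} {z : ℂ}
    (h1 : 2 * I * (conj z - z) * ∑' m, conj (e m z) * e m z =
      E z * conj (E z) - conj (E (conj z)) * E (conj z)) :
    4 * z.im * ∑' m, ‖e m z‖ ^ 2 = ‖E z‖ ^ 2 - ‖E (conj z)‖ ^ 2 := by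
  have h2 : ∀ m, conj (e m z) * e m z = ((‖e m z‖ ^ 2 : ℝ) : ℂ) := fun m => by
    rw [conj_mul']; push_cast; rfl
  simp_rw [h2] at h1
  rw [← ofReal_tsum, mul_conj', conj_mul'] at h1
  have h3 : 2 * I * (conj z - z) = ((4 * z.im : ℝ) : ℂ) := by
    have := sub_conj z
    push_cast at this ⊢
    linear_combination (-2 * I) * this - 4 * z.im * I_sq
  rw [h3] at h1
  exact_mod_cast h1

namespace IsKernelExpansion

variable {E : ℂ → ℂ} {e : ℤ → ℂ → ℂ}

theorem summable_kernel (h : IsKernelExpansion E e) (w z : ℂ) :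
    Summable fun m => conj (e m w) * e m z := by
  refine Summable.of_norm_bounded ((h.sqSummable w).add (h.sqSummable z)) fun m => ?_
  rw [norm_mul, norm_conj]
  nlinarith [sq_nonneg (‖e m w‖ - ‖e m z‖), sq_nonneg ‖e m w‖, sq_nonneg ‖e m z‖]

theorem four_im_mul_tsum (h : IsKernelExpansion E e) (z : ℂ) :
    4 * z.im * ∑' m, ‖e m z‖ ^ 2 = ‖E z‖ ^ 2 - ‖E (conj z)‖ ^ 2 :=
  four_im_mul_tsum_of_kernel (h.kernel z z)

theorem sum_sq_le (h : IsKernelExpansion E e) {z : ℂ} (hz : 0 < z.im) (s : Finset ℤ) :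
    ∑ m ∈ s, ‖e m z‖ ^ 2 ≤ ‖E z‖ ^ 2 / (4 * z.im) := by
  rw [le_div_iff₀ (by positivity)]
  have h1 := h.four_im_mul_tsum z
  have h2 := (h.sqSummable z).sum_le_tsum s fun m _ => sq_nonneg _
  nlinarith [sq_nonneg ‖E (conj z)‖]

/-! ### Bessel's inequality along horizontal lines -/

theorem im_line (x y : ℝ) : ((x : ℂ) + y * I).im = y := by simp

theorem line_ne_zero (h : IsKernelExpansion E e) {y : ℝ} (hy : 0 < y) (x : ℝ) :
    E (x + y * I) ≠ 0 := h.ne_zero _ (by rw [im_line]; exact hy.le)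

theorem continuous_line (h : IsKernelExpansion E e) {y : ℝ} (hy : 0 < y) (m : ℤ) :
    Continuous fun x : ℝ => e m (x + y * I) / E (x + y * I) :=
  Continuous.div ((h.differentiable m).continuous.comp (by fun_prop))
    (h.differentiable_E.continuous.comp (by fun_prop)) (h.line_ne_zero hy)

theorem sum_line_sq_le (h : IsKernelExpansion E e) {y : ℝ} (hy : 0 < y) (x : ℝ) (s : Finset ℤ) :
    ∑ m ∈ s, ‖e m (x + y * I) / E (x + y * I)‖ ^ 2 ≤ (4 * y)⁻¹ := by
  have h1 := h.sum_sq_le (z := x + y * I) (by rw [im_line]; exact hy) s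
  have h0 : 0 < ‖E (x + y * I)‖ ^ 2 := by
    have := norm_pos_iff.2 (h.line_ne_zero hy x)
    positivity
  simp_rw [norm_div, div_pow]
  rw [← Finset.sum_div, div_le_iff₀ h0]
  rw [im_line] at h1
  exact h1.trans_eq (by ring)

theorem hasSum_line (h : IsKernelExpansion E e) {y : ℝ} (hy : 0 < y) (x t : ℝ) :
    HasSum (fun m => e m (x + y * I) / E (x + y * I) * conj (e m (t + y * I) / E (t + y * I)))
      ((1 - conj (E (conj (x + y * I))) / E (x + y * I) *
        conj (conj (E (conj (t + y * I))) / E (t + y * I))) / (4 * y + 2 * I * (t - x))) := by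
  have hk := h.kernel (t + y * I) (x + y * I)
  have hs := (h.summable_kernel (t + y * I) (x + y * I)).hasSum
  have hx := h.line_ne_zero hy x
  have ht := h.line_ne_zero hy t
  have ht' : conj (E (t + y * I)) ≠ 0 := by simpa using ht
  have hd := cauchyKernel_denom_ne_zero hy x t
  have hd' : 2 * I * (conj ((t : ℂ) + y * I) - (x + y * I)) = 4 * y + 2 * I * (t - x) := by
    simp only [map_add, map_mul, conj_ofReal, conj_I]
    linear_combination (-4 * (y : ℂ)) * I_sq
  rw [hd'] at hk
  have hs' := hs.div_const (E (x + y * I) * conj (E (t + y * I)))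
  have hval : (∑' m, conj (e m (t + y * I)) * e m (x + y * I)) /
      (E (x + y * I) * conj (E (t + y * I))) =
      ((1 - conj (E (conj (x + y * I))) / E (x + y * I) *
        conj (conj (E (conj (t + y * I))) / E (t + y * I))) / (4 * y + 2 * I * (t - x))) := by
    set S := ∑' m, conj (e m (t + y * I)) * e m (x + y * I)
    rw [map_div₀, conj_conj]
    rw [div_eq_div_iff (mul_ne_zero hx ht') hd, mul_comm S, hk]
    field_simp
  rw [hval] at hs'
  refine hs'.congr_fun fun m => ?_
  rw [map_div₀, div_mul_div_comm, mul_comm (e m _)]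

/-- Bessel's inequality for the functions `e m / E` on a horizontal line. Their Gram kernel is
`(1 - θ(x) θ(t)*) / (4 y + 2 i (t - x))`; subtracting the nonnegative form of the second
term only decreases the form of the Cauchy kernel. -/
theorem sum_norm_integral_sq_le (h : IsKernelExpansion E e) {y : ℝ} (hy : 0 < y) {μ : Measure ℝ}
    [SFinite μ] (hμ : μ ≤ volume) {p : ℝ → ℂ} (hp : Integrable p μ)
    (hp2 : Integrable (fun x => ‖p x‖ ^ 2) μ)
    (s : Finset ℤ) :
    ∑ m ∈ s, ‖∫ x, conj (p x) * (e m (x + y * I) / E (x + y * I)) ∂μ‖ ^ 2 ≤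
      Real.pi * ∫ x, ‖p x‖ ^ 2 ∂μ := by
  set ε : ℤ → ℝ → ℂ := fun m x => e m (x + y * I) / E (x + y * I) with hε
  set θ : ℝ → ℂ := fun x => conj (E (conj (x + y * I))) / E (x + y * I) with hθ
  have hεc : ∀ m, Continuous (ε m) := h.continuous_line hy
  have hεb : ∀ s x, ∑ m ∈ s, ‖ε m x‖ ^ 2 ≤ (4 * y)⁻¹ := fun s x => h.sum_line_sq_le hy x s
  have hθc : Continuous θ := by
    have hE := h.differentiable_E.continuous
    exact Continuous.div (by fun_prop) (by fun_prop) (h.line_ne_zero hy)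
  have hθb : ∀ x, ‖θ x‖ ≤ 1 := fun x => by
    have h1 := h.four_im_mul_tsum (x + y * I)
    have h2 : 0 ≤ ∑' m, ‖e m (x + y * I)‖ ^ 2 := tsum_nonneg fun m => sq_nonneg _
    rw [im_line] at h1
    have h3 : ‖E (conj (x + y * I))‖ ≤ ‖E (x + y * I)‖ :=
      le_of_sq_le_sq (by nlinarith [mul_nonneg hy.le h2]) (norm_nonneg _)
    rw [hθ, norm_div, norm_conj]
    exact div_le_one_of_le₀ h3 (norm_nonneg _)
  have hpθ : Integrable (fun x => p x * conj (θ x)) μ :=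
    hp.mul_bdd (c := 1) (continuous_conj.comp hθc).aestronglyMeasurable
      (Eventually.of_forall fun x => by simpa using hθb x)
  set c : ℤ → ℂ := fun m => ∫ x, conj (p x) * ε m x ∂μ with hc
  -- finite Gram sums are uniformly bounded, so that the double integrals converge to the full form
  have hPP : Integrable (fun q : ℝ × ℝ => conj (p q.1) * p q.2) (μ.prod μ) :=
    (integrable_conj hp).mul_prod hp
  have hgram : ∀ q : ℝ × ℝ, ∀ s : Finset ℤ, ‖∑ m ∈ s, ε m q.1 * conj (ε m q.2)‖ ≤ (4 * y)⁻¹ := by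
    intro q s
    have h1 : ∀ m ∈ s, ‖ε m q.1 * conj (ε m q.2)‖ ≤ (‖ε m q.1‖ ^ 2 + ‖ε m q.2‖ ^ 2) / 2 := by
      intro m _
      rw [norm_mul, norm_conj]
      nlinarith [sq_nonneg (‖ε m q.1‖ - ‖ε m q.2‖)]
    refine (norm_sum_le_of_le s h1).trans ?_
    rw [← Finset.sum_div, Finset.sum_add_distrib]
    linarith [hεb s q.1, hεb s q.2]
  have hsum : ∀ s : Finset ℤ, ((∑ m ∈ s, ‖c m‖ ^ 2 : ℝ) : ℂ) =
      ∫ q : ℝ × ℝ, conj (p q.1) * p q.2 * ∑ m ∈ s, ε m q.1 * conj (ε m q.2) ∂(μ.prod μ) := by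
    intro s
    have hεb1 : ∀ m x, ‖ε m x‖ ≤ √((4 * y)⁻¹) := fun m x => by
      refine Real.le_sqrt_of_sq_le ?_
      simpa using hεb {m} x
    have h1 : ∀ m, ((‖c m‖ ^ 2 : ℝ) : ℂ) = ∫ q : ℝ × ℝ, (conj (p q.1) * ε m q.1) *
        conj (conj (p q.2) * ε m q.2) ∂(μ.prod μ) := fun m => by
      rw [integral_prod_mul (fun x => conj (p x) * ε m x) (fun x => conj (conj (p x) * ε m x)),
        integral_conj, mul_conj']
      push_cast
      rfl
    have h2 : ∀ m, Integrable (fun x => conj (p x) * ε m x) μ := fun m =>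
      (integrable_conj hp).mul_bdd (hεc m).aestronglyMeasurable
        (Eventually.of_forall fun x => hεb1 m x)
    push_cast
    have h3 : ∀ m, ((‖c m‖ : ℂ)) ^ 2 = ((‖c m‖ ^ 2 : ℝ) : ℂ) := fun m => by push_cast; rfl
    simp_rw [h3, h1]
    rw [← integral_finsetSum _ fun m _ => (h2 m).mul_prod (integrable_conj (h2 m))]
    refine integral_congr_ae (Eventually.of_forall fun q => ?_)
    simp only [Finset.mul_sum, map_mul, conj_conj]
    refine Finset.sum_congr rfl fun m _ => ?_
    ring
  have hlim : Tendsto (fun s : Finset ℤ => ((∑ m ∈ s, ‖c m‖ ^ 2 : ℝ) : ℂ)) atTop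
      (𝓝 (∫ q : ℝ × ℝ, conj (p q.1) * p q.2 *
        ((1 - θ q.1 * conj (θ q.2)) / (4 * y + 2 * I * (q.2 - q.1))) ∂(μ.prod μ))) := by
    simp_rw [hsum]
    refine tendsto_integral_filter_of_dominated_convergence
      (fun q => ‖conj (p q.1) * p q.2‖ * (4 * y)⁻¹) ?_ ?_ (hPP.norm.mul_const _) ?_
    · refine Eventually.of_forall fun s => hPP.aestronglyMeasurable.mul ?_
      refine Continuous.aestronglyMeasurable ?_
      refine continuous_finsetSum _ fun m _ => ?_
      exact ((hεc m).comp continuous_fst).mul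
        (continuous_conj.comp ((hεc m).comp continuous_snd))
    · refine Eventually.of_forall fun s => Eventually.of_forall fun q => ?_
      rw [norm_mul]
      exact mul_le_mul_of_nonneg_left (hgram q s) (norm_nonneg _)
    · exact Eventually.of_forall fun q => (h.hasSum_line hy q.1 q.2).const_mul _
  have hval : ∫ q : ℝ × ℝ, conj (p q.1) * p q.2 *
        ((1 - θ q.1 * conj (θ q.2)) / (4 * y + 2 * I * (q.2 - q.1))) ∂(μ.prod μ) =
      cauchyForm μ y p - cauchyForm μ y (fun x => p x * conj (θ x)) := by
    rw [cauchyForm, cauchyForm, ← integral_sub (integrable_cauchyForm hy (integrable_conj hp) hp)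
      (integrable_cauchyForm hy (integrable_conj hpθ) hpθ)]
    refine integral_congr_ae (Eventually.of_forall fun q => ?_)
    simp only [map_mul, conj_conj]
    ring
  rw [hval] at hlim
  have hlim' : Tendsto (fun s : Finset ℤ => ∑ m ∈ s, ‖c m‖ ^ 2) atTop
      (𝓝 (cauchyForm μ y p - cauchyForm μ y (fun x => p x * conj (θ x))).re) := by
    simpa only [Function.comp_def, ofReal_re] using (continuous_re.tendsto _).comp hlim
  have hHS : HasSum (fun m => ‖c m‖ ^ 2)
      (cauchyForm μ y p - cauchyForm μ y (fun x => p x * conj (θ x))).re := by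
    simpa only [HasSum, SummationFilter.unconditional_filter] using hlim'
  have hle := sum_le_hasSum s (fun m _ => sq_nonneg ‖c m‖) hHS
  refine hle.trans ?_
  rw [sub_re]
  linarith [cauchyForm_re_nonneg hy hpθ, cauchyForm_re_le hμ hy hp hp2]

/-- The dual form of Bessel's inequality, from its application to the sum `p` itself. The interval
is bounded because the square integrability of `p` on the line is not yet known. -/
theorem setIntegral_norm_sum_sq_le (h : IsKernelExpansion E e) {y : ℝ} (hy : 0 < y) (R : ℝ)
    (s : Finset ℤ) (v : ℤ → ℂ) :
    ∫ x in Set.Icc (-R) R, ‖∑ m ∈ s, e m (x + y * I) / E (x + y * I) * v m‖ ^ 2 ≤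
      Real.pi * ∑ m ∈ s, ‖v m‖ ^ 2 := by
  set μ := volume.restrict (Set.Icc (-R) R) with hμ
  set p : ℝ → ℂ := fun x => ∑ m ∈ s, e m (x + y * I) / E (x + y * I) * v m with hp
  have hpc : Continuous p := continuous_finsetSum _ fun m _ =>
    (h.continuous_line hy m).mul continuous_const
  have hpi : Integrable p μ := hpc.integrableOn_Icc
  have hpi2 : Integrable (fun x => ‖p x‖ ^ 2) μ := (hpc.norm.pow 2).integrableOn_Icc
  have hB := h.sum_norm_integral_sq_le hy Measure.restrict_le_self hpi hpi2 s
  set c : ℤ → ℂ := fun m => ∫ x, conj (p x) * (e m (x + y * I) / E (x + y * I)) ∂μ with hc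
  set N := ∫ x, ‖p x‖ ^ 2 ∂μ with hN
  have hN0 : 0 ≤ N := integral_nonneg fun x => sq_nonneg _
  set V := ∑ m ∈ s, ‖v m‖ ^ 2 with hV
  have hV0 : 0 ≤ V := Finset.sum_nonneg fun m _ => sq_nonneg _
  have h1 : (N : ℂ) = ∑ m ∈ s, c m * v m := by
    rw [hN, ← integral_complex_ofReal]
    have h2 : ∀ x, ((‖p x‖ ^ 2 : ℝ) : ℂ) =
        ∑ m ∈ s, conj (p x) * (e m (x + y * I) / E (x + y * I)) * v m := fun x => by
      have : ((‖p x‖ ^ 2 : ℝ) : ℂ) = conj (p x) * p x := by rw [conj_mul']; push_cast; rfl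
      rw [this]
      conv_lhs => rw [hp]
      simp only [Finset.mul_sum, mul_assoc]
      rfl
    simp_rw [h2]
    rw [integral_finsetSum]
    · refine Finset.sum_congr rfl fun m _ => ?_
      rw [integral_mul_const]
    · intro m _
      exact ((((continuous_conj.comp hpc).mul (h.continuous_line hy m)).mul
        continuous_const).integrableOn_Icc)
  have h3 : N ≤ ∑ m ∈ s, ‖c m‖ * ‖v m‖ := by
    have h4 : ‖(N : ℂ)‖ ≤ ∑ m ∈ s, ‖c m‖ * ‖v m‖ := by
      rw [h1]
      exact norm_sum_le_of_le s fun m _ => (norm_mul _ _).le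
    rwa [norm_real, Real.norm_of_nonneg hN0] at h4
  have h5 := Finset.sum_mul_sq_le_sq_mul_sq s (fun m => ‖c m‖) fun m => ‖v m‖
  have h6 : N ^ 2 ≤ (Real.pi * N) * V := by
    refine (pow_le_pow_left₀ hN0 h3 2).trans (h5.trans ?_)
    exact mul_le_mul_of_nonneg_right hB hV0
  rcases hN0.eq_or_lt with h7 | h7
  · rw [← h7]
    have := Real.pi_pos
    positivity
  · nlinarith

/-! ### The transform attached to a kernel expansion -/

/-- Local boundedness of `∑ ‖e m z‖²`. At non-real points of a disk the sum is a difference quotient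
of `‖E‖²` across the real line, so a Lipschitz bound for `E` controls it; real points follow by
continuity of the finite sums. -/
theorem exists_sum_sq_le (h : IsKernelExpansion E e) (R : ℝ) :
    ∃ M : ℝ, 0 ≤ M ∧ ∀ z : ℂ, ‖z‖ ≤ R → ∀ s : Finset ℤ, ∑ m ∈ s, ‖e m z‖ ^ 2 ≤ M := by
  have hE := h.differentiable_E
  obtain ⟨A, hA⟩ := (isCompact_closedBall (0 : ℂ) (R + 1)).exists_bound_of_continuousOn
    hE.continuous.continuousOn
  obtain ⟨L, hL⟩ := (isCompact_closedBall (0 : ℂ) (R + 1)).exists_bound_of_continuousOn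
    (hE.contDiff (n := 1)).continuous_deriv_one.continuousOn
  -- the bound at non-real points
  have hnr : ∀ z : ℂ, ‖z‖ ≤ R + 1 → z.im ≠ 0 → ∀ s : Finset ℤ,
      ∑ m ∈ s, ‖e m z‖ ^ 2 ≤ |A * L| := by
    intro z hz him s
    have hzm : z ∈ Metric.closedBall (0 : ℂ) (R + 1) := by simpa using hz
    have hcm : conj z ∈ Metric.closedBall (0 : ℂ) (R + 1) := by simpa using hz
    have hA0 : 0 ≤ A := (norm_nonneg _).trans (hA z hzm)
    have hlip := (convex_closedBall (0 : ℂ) (R + 1)).norm_image_sub_le_of_norm_deriv_le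
      (fun w _ => hE w) hL hcm hzm
    have hsub : ‖z - conj z‖ = 2 * |z.im| := by
      rw [sub_conj, norm_mul, norm_I, mul_one, norm_real, Real.norm_eq_abs, abs_mul]
      norm_num
    rw [hsub] at hlip
    have hs := (h.sqSummable z).sum_le_tsum s fun m _ => sq_nonneg ‖e m z‖
    have h4 := congrArg abs (h.four_im_mul_tsum z)
    have ht0 : 0 ≤ ∑' m, ‖e m z‖ ^ 2 := tsum_nonneg fun m => sq_nonneg _
    rw [abs_mul, abs_mul, abs_of_nonneg ht0, sq_sub_sq, abs_mul,
      abs_of_nonneg (by positivity : 0 ≤ ‖E z‖ + ‖E (conj z)‖)] at h4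
    have h5 : |‖E z‖ - ‖E (conj z)‖| ≤ L * (2 * |z.im|) :=
      (abs_norm_sub_norm_le _ _).trans hlip
    have h6 : ‖E z‖ + ‖E (conj z)‖ ≤ 2 * A := by linarith [hA z hzm, hA _ hcm]
    have h7 : |(4 : ℝ)| * |z.im| * ∑' m, ‖e m z‖ ^ 2 ≤ 2 * A * (L * (2 * |z.im|)) := by
      rw [h4]
      exact mul_le_mul h6 h5 (abs_nonneg _) (by positivity)
    rw [abs_of_nonneg (by norm_num : (0 : ℝ) ≤ 4)] at h7
    have him' : 0 < |z.im| := abs_pos.2 him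
    have h8 : ∑' m, ‖e m z‖ ^ 2 ≤ A * L := by
      refine le_of_mul_le_mul_left ?_ (by positivity : 0 < 4 * |z.im|)
      linarith
    exact hs.trans (h8.trans (le_abs_self _))
  refine ⟨|A * L|, abs_nonneg _, fun z hz s => ?_⟩
  by_cases him : z.im = 0
  · have hcont : Continuous fun t : ℝ => ∑ m ∈ s, ‖e m (z + t * I)‖ ^ 2 :=
      continuous_finsetSum _ fun m _ =>
        (((h.differentiable m).continuous.comp (by fun_prop)).norm.pow 2)
    have ht : Tendsto (fun t : ℝ => ∑ m ∈ s, ‖e m (z + t * I)‖ ^ 2) (𝓝[>] 0)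
        (𝓝 (∑ m ∈ s, ‖e m z‖ ^ 2)) := by
      have := (hcont.tendsto 0).mono_left (nhdsWithin_le_nhds (s := Set.Ioi (0 : ℝ)))
      simpa using this
    refine le_of_tendsto ht ?_
    filter_upwards [Ioc_mem_nhdsGT (zero_lt_one' ℝ)] with t ht
    refine hnr _ ?_ ?_ s
    · refine (norm_add_le _ _).trans (add_le_add hz ?_)
      rw [norm_mul, norm_I, mul_one, norm_real, Real.norm_of_nonneg ht.1.le]
      exact ht.2
    · simp [him, ht.1.ne']
  · exact hnr z (by linarith) him s

/-- The vector `(e m (z)*)ₘ` of `ℓ²`, which represents the evaluation at `z`. -/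
def kernelVector (h : IsKernelExpansion E e) (z : ℂ) : lp (fun _ : ℤ => ℂ) 2 :=
  ⟨fun m => conj (e m z), by
    refine memℓp_gen ?_
    simpa using h.sqSummable z⟩

theorem kernelVector_apply (h : IsKernelExpansion E e) (z : ℂ) (m : ℤ) :
    h.kernelVector z m = conj (e m z) := rfl

theorem hasSum_transform (h : IsKernelExpansion E e) (v : lp (fun _ : ℤ => ℂ) 2) (z : ℂ) :
    HasSum (fun m => e m z * v m) (inner ℂ (h.kernelVector z) v) := by
  have := lp.hasSum_inner (𝕜 := ℂ) (h.kernelVector z) v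
  refine this.congr_fun fun m => ?_
  rw [RCLike.inner_apply, kernelVector_apply, conj_conj, mul_comm]

theorem hasSum_norm_sq (v : lp (fun _ : ℤ => ℂ) 2) : HasSum (fun m => ‖v m‖ ^ 2) (‖v‖ ^ 2) := by
  have := lp.hasSum_norm (p := 2) (by norm_num) v
  simpa using this

theorem exists_norm_kernelVector_le (h : IsKernelExpansion E e) (R : ℝ) :
    ∃ M : ℝ, 0 ≤ M ∧ ∀ z : ℂ, ‖z‖ ≤ R → ‖h.kernelVector z‖ ≤ M := by
  obtain ⟨M, hM, hb⟩ := h.exists_sum_sq_le R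
  refine ⟨√M, Real.sqrt_nonneg _, fun z hz => Real.le_sqrt_of_sq_le ?_⟩
  refine hasSum_le_of_sum_le (hasSum_norm_sq (h.kernelVector z)) fun s => ?_
  simpa [kernelVector_apply] using hb z hz s

/-- The transform `v ↦ ∑ₘ e m (z) v m`. -/
def transform (e : ℤ → ℂ → ℂ) (v : ℤ → ℂ) (z : ℂ) : ℂ := ∑' m, e m z * v m

theorem transform_eq_inner (h : IsKernelExpansion E e) (v : lp (fun _ : ℤ => ℂ) 2) (z : ℂ) :
    transform e v z = inner ℂ (h.kernelVector z) v := (h.hasSum_transform v z).tsum_eq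

theorem differentiable_transform (h : IsKernelExpansion E e) (v : lp (fun _ : ℤ => ℂ) 2) :
    Differentiable ℂ (transform e v) := by
  have hfin : ∀ s : Finset ℤ, ∀ z, inner ℂ (h.kernelVector z) (∑ m ∈ s, lp.single 2 m (v m)) =
      ∑ m ∈ s, e m z * v m := fun s z => by
    rw [inner_sum]
    refine Finset.sum_congr rfl fun m _ => ?_
    rw [lp.inner_single_right, RCLike.inner_apply, kernelVector_apply, conj_conj, mul_comm]
  have hlim : Tendsto (fun s : Finset ℤ => ∑ m ∈ s, lp.single 2 m (v m)) atTop (𝓝 v) := by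
    simpa only [HasSum, SummationFilter.unconditional_filter] using
      lp.hasSum_single (p := 2) (by norm_num) v
  have hloc : TendstoLocallyUniformlyOn (fun (s : Finset ℤ) z => ∑ m ∈ s, e m z * v m)
      (transform e v) atTop Set.univ := by
    rw [Metric.tendstoLocallyUniformlyOn_iff]
    intro ε hε z _
    obtain ⟨M, hM, hMb⟩ := h.exists_norm_kernelVector_le (‖z‖ + 1)
    refine ⟨Metric.ball z 1, mem_nhdsWithin_of_mem_nhds (Metric.ball_mem_nhds z one_pos), ?_⟩
    filter_upwards [(Metric.tendsto_nhds.1 hlim) (ε / (M + 1)) (by positivity)] with s hs w hw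
    rw [dist_eq_norm, h.transform_eq_inner, ← hfin, ← inner_sub_right]
    refine (norm_inner_le_norm _ _).trans_lt ?_
    rw [dist_comm, dist_eq_norm, lt_div_iff₀ (by positivity)] at hs
    have hw' : ‖w‖ ≤ ‖z‖ + 1 := by
      have := norm_sub_norm_le w z
      rw [Metric.mem_ball, dist_eq_norm] at hw
      linarith
    have h1 := hMb w hw'
    have h2 := mul_le_mul_of_nonneg_right h1
      (norm_nonneg (v - ∑ m ∈ s, lp.single 2 m (v m)))
    nlinarith [norm_nonneg (v - ∑ m ∈ s, lp.single 2 m (v m))]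
  have := hloc.differentiableOn (Eventually.of_forall fun s => ?_) isOpen_univ
  · rwa [differentiableOn_univ] at this
  · exact Differentiable.differentiableOn
      (Differentiable.fun_sum fun m _ => (h.differentiable m).mul_const _)

theorem sharp_transform (h : IsKernelExpansion E e) (v : lp (fun _ : ℤ => ℂ) 2) :
    sharp (transform e v) = transform e (star v) := by
  funext z
  simp only [sharp, transform, conj_tsum, map_mul, h.real, conj_conj]
  rfl

/-- The transform is bounded by `√π` along every horizontal line of the upper half-plane. -/
theorem eLpNorm_transform_line_le (h : IsKernelExpansion E e) (v : lp (fun _ : ℤ => ℂ) 2) {y : ℝ}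
    (hy : 0 < y) :
    eLpNorm (fun x : ℝ => transform e v (x + y * I) / E (x + y * I)) 2 volume ≤
      (NNReal.sqrt NNReal.pi * ‖v‖₊ : ℝ≥0) := by
  set S : ℕ → Finset ℤ := fun k => Finset.Icc (-(k : ℤ)) k with hS
  have hSt : Tendsto S atTop atTop := by
    refine tendsto_atTop_finset_of_monotone (fun k l hkl => ?_) fun m => ⟨m.natAbs, ?_⟩
    · exact Finset.Icc_subset_Icc (by simpa using hkl) (by simpa using hkl)
    · rw [hS, Finset.mem_Icc]
      omega
  set p : ℕ → ℝ → ℂ := fun k x => ∑ m ∈ S k, e m (x + y * I) / E (x + y * I) * v m with hp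
  have hpc : ∀ k, Continuous (p k) := fun k => continuous_finsetSum _ fun m _ =>
    (h.continuous_line hy m).mul continuous_const
  set F : ℕ → ℝ → ℂ := fun k => Set.indicator (Set.Icc (-(k : ℝ)) k) (p k) with hF
  have hFm : ∀ k, AEStronglyMeasurable (F k) volume := fun k =>
    (hpc k).aestronglyMeasurable.indicator measurableSet_Icc
  have hFle : ∀ k, eLpNorm (F k) 2 volume ≤ (NNReal.sqrt NNReal.pi * ‖v‖₊ : ℝ≥0) := fun k => by
    rw [hF, eLpNorm_indicator_eq_eLpNorm_restrict measurableSet_Icc]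
    refine eLpNorm_two_le_of_integral_le (hpc k).aestronglyMeasurable
      ((hpc k).norm.pow 2).integrableOn_Icc ?_
    refine (h.setIntegral_norm_sum_sq_le hy k (S k) v).trans ?_
    push_cast
    rw [mul_pow, Real.sq_sqrt (NNReal.coe_nonneg _), NNReal.coe_real_pi]
    refine mul_le_mul_of_nonneg_left ?_ Real.pi_pos.le
    exact sum_le_hasSum (S k) (fun m _ => sq_nonneg _) (hasSum_norm_sq v)
  have hlim : ∀ x : ℝ, Tendsto (fun k => F k x) atTop
      (𝓝 (transform e v (x + y * I) / E (x + y * I))) := fun x => by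
    have h1 := (h.hasSum_transform v (x + y * I)).div_const (E (x + y * I))
    rw [← h.transform_eq_inner] at h1
    have h2 : Tendsto (fun k => ∑ m ∈ S k, e m (x + y * I) * v m / E (x + y * I)) atTop
        (𝓝 (transform e v (x + y * I) / E (x + y * I))) := by
      rw [HasSum, SummationFilter.unconditional_filter] at h1
      exact h1.comp hSt
    refine h2.congr' ?_
    obtain ⟨N, hN⟩ := exists_nat_ge |x|
    filter_upwards [eventually_ge_atTop N] with k hk
    have hxk : x ∈ Set.Icc (-(k : ℝ)) k := by
      rw [Set.mem_Icc, ← abs_le]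
      exact hN.trans (by exact_mod_cast hk)
    rw [hF]
    simp only [Set.indicator_of_mem hxk, hp]
    refine Finset.sum_congr rfl fun m _ => ?_
    rw [div_mul_eq_mul_div]
  refine (Lp.eLpNorm_lim_le_liminf_eLpNorm hFm _ (Eventually.of_forall hlim)).trans ?_
  exact liminf_le_of_le (by isBoundedDefault) fun b hb => by
    obtain ⟨k, hk⟩ := hb.exists
    exact hk.trans (hFle k)

theorem eLpNorm_transform_real_le (h : IsKernelExpansion E e) (v : lp (fun _ : ℤ => ℂ) 2) :
    eLpNorm (fun x : ℝ => transform e v x / E x) 2 volume ≤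
      (NNReal.sqrt NNReal.pi * ‖v‖₊ : ℝ≥0) := by
  set y : ℕ → ℝ := fun k => 1 / ((k : ℝ) + 1) with hy
  have hy0 : ∀ k, 0 < y k := fun k => by positivity
  have hylim : Tendsto y atTop (𝓝 0) := tendsto_one_div_add_atTop_nhds_zero_nat
  have hT := (h.differentiable_transform v).continuous
  have hE := h.differentiable_E.continuous
  have hm : ∀ k, AEStronglyMeasurable
      (fun x : ℝ => transform e v (x + y k * I) / E (x + y k * I)) volume := fun k =>
    (Continuous.div (by fun_prop) (by fun_prop) (h.line_ne_zero (hy0 k))).aestronglyMeasurable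
  have hlim : ∀ x : ℝ, Tendsto (fun k => transform e v (x + y k * I) / E (x + y k * I)) atTop
      (𝓝 (transform e v x / E x)) := fun x => by
    have h1 : ContinuousAt (fun t : ℝ => transform e v (x + t * I) / E (x + t * I)) 0 := by
      refine ContinuousAt.div (by fun_prop) (by fun_prop) ?_
      simpa using h.ne_zero x (by simp)
    have h2 := h1.tendsto.comp hylim
    simpa [Function.comp_def] using h2
  refine (Lp.eLpNorm_lim_le_liminf_eLpNorm hm _ (Eventually.of_forall hlim)).trans ?_
  exact liminf_le_of_le (by isBoundedDefault) fun b hb => by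
    obtain ⟨k, hk⟩ := hb.exists
    exact hk.trans (h.eLpNorm_transform_line_le v (hy0 k))

theorem isHardyTwo_transform_div (h : IsKernelExpansion E e) (v : lp (fun _ : ℤ => ℂ) 2) :
    IsHardyTwo fun z => transform e v z / E z :=
  ⟨fun z hz => ((h.differentiable_transform v z).div (h.differentiable_E z)
    (h.ne_zero z (le_of_lt hz))).differentiableWithinAt, _,
    fun _ hy => h.eLpNorm_transform_line_le v hy⟩

theorem transform_mem (h : IsKernelExpansion E e) (v : lp (fun _ : ℤ => ℂ) 2) :
    transform e v ∈ deBrangesSubmodule E := by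
  refine ⟨h.differentiable_transform v, ⟨?_, ?_⟩, h.isHardyTwo_transform_div v, ?_⟩
  · exact (Continuous.div ((h.differentiable_transform v).continuous.comp continuous_ofReal)
      (h.differentiable_E.continuous.comp continuous_ofReal)
      fun x => h.ne_zero x (by simp)).aestronglyMeasurable
  · exact (h.eLpNorm_transform_real_le v).trans_lt ENNReal.coe_lt_top
  · rw [h.sharp_transform]
    exact h.isHardyTwo_transform_div (star v)

/-! ### The transform maps onto the de Branges space -/

theorem norm_sq_eq_integral (F : DeBrangesSpace E) :
    ‖F‖ ^ 2 = 1 / Real.pi * ∫ x : ℝ, ‖F.toFun x / E x‖ ^ 2 := by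
  have h1 := inner_self_eq_norm_sq_to_K (𝕜 := ℂ) F
  rw [DeBrangesSpace.inner_def] at h1
  have h2 : ∀ x : ℝ, conj (F.toFun x) * F.toFun x / ((‖E x‖ ^ 2 : ℝ) : ℂ) =
      ((‖F.toFun x / E x‖ ^ 2 : ℝ) : ℂ) := fun x => by
    rw [conj_mul', norm_div, div_pow]; push_cast; rfl
  simp_rw [h2] at h1
  rw [integral_complex_ofReal] at h1
  have h3 : ((1 / Real.pi * ∫ x : ℝ, ‖F.toFun x / E x‖ ^ 2 : ℝ) : ℂ) = ((‖F‖ ^ 2 : ℝ) : ℂ) := by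
    rw [ofReal_mul, h1]
    push_cast
    rfl
  exact_mod_cast h3.symm

/-- The transform, as an operator from `ℓ²` into the de Branges space. -/
def transformLM (h : IsKernelExpansion E e) :
    lp (fun _ : ℤ => ℂ) 2 →ₗ[ℂ] DeBrangesSpace E where
  toFun v := ⟨transform e v, h.transform_mem v⟩
  map_add' v w := Subtype.ext <| by
    funext z
    change transform e (v + w) z = transform e v z + transform e w z
    have := (h.transform_eq_inner (v + w) z).trans (inner_add_right _ _ _)
    rwa [← h.transform_eq_inner, ← h.transform_eq_inner] at this
  map_smul' c v := Subtype.ext <| by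
    funext z
    change transform e (c • v) z = c * transform e v z
    have := (h.transform_eq_inner (c • v) z).trans (inner_smul_right _ _ _)
    rwa [← h.transform_eq_inner] at this

theorem toFun_transformLM (h : IsKernelExpansion E e) (v : lp (fun _ : ℤ => ℂ) 2) :
    (h.transformLM v).toFun = transform e v := rfl

theorem norm_transformLM_le (h : IsKernelExpansion E e) (v : lp (fun _ : ℤ => ℂ) 2) :
    ‖h.transformLM v‖ ≤ ‖v‖ := by
  have h1 := (memLp_two_of_eLpNorm_le (h.transform_mem v).2.1.aestronglyMeasurable
    (h.eLpNorm_transform_real_le v)).2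
  refine le_of_sq_le_sq ?_ (norm_nonneg _)
  rw [norm_sq_eq_integral, toFun_transformLM, one_div_mul_eq_div, div_le_iff₀ Real.pi_pos]
  refine h1.trans_eq ?_
  push_cast
  rw [mul_pow, Real.sq_sqrt (NNReal.coe_nonneg _), NNReal.coe_real_pi, mul_comm]

/-- The contraction from `ℓ²` into the de Branges space given by the transform. -/
def transformCLM (h : IsKernelExpansion E e) :
    lp (fun _ : ℤ => ℂ) 2 →L[ℂ] DeBrangesSpace E :=
  h.transformLM.mkContinuous 1 fun v => by simpa using h.norm_transformLM_le v

theorem toFun_transformCLM (h : IsKernelExpansion E e) (v : lp (fun _ : ℤ => ℂ) 2) :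
    (h.transformCLM v).toFun = transform e v := rfl

theorem inner_kernelVector_transform (h : IsKernelExpansion E e) (F : DeBrangesSpace E) {w : ℂ}
    (hw : 0 < w.im) : inner ℂ (h.transformCLM (h.kernelVector w)) F = F.toFun w := by
  have h1 := deBranges_reproducing h.differentiable_E h.ne_zero F.toFun_mem hw
  rw [DeBrangesSpace.inner_def]
  have h2 : ∀ x : ℝ, conj ((h.transformCLM (h.kernelVector w)).toFun x) =
      (E w * conj (E x) - conj (E (conj w)) * E x) / (2 * I * (x - w)) := fun x => by
    have hxw : (2 * I * ((x : ℂ) - w)) ≠ 0 := by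
      refine mul_ne_zero (mul_ne_zero two_ne_zero I_ne_zero) fun h0 => ?_
      have := congrArg Complex.im h0
      simp at this
      exact hw.ne' this
    have h3 : (h.transformCLM (h.kernelVector w)).toFun x = ∑' m, conj (e m w) * e m x := by
      rw [toFun_transformCLM, transform]
      exact tsum_congr fun m => mul_comm _ _
    have h4 := congrArg conj (h.kernel w x)
    rw [h3, eq_div_iff hxw, mul_comm]
    simp only [map_mul, map_sub, conj_conj, conj_ofReal, conj_I, map_ofNat] at h4
    linear_combination h4
  simp_rw [h2]
  rw [h1]
  push_cast
  have : (Real.pi : ℂ) ≠ 0 := by exact_mod_cast Real.pi_ne_zero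
  field_simp

theorem eq_of_eq_upperHalfPlane {F G : ℂ → ℂ} (hF : Differentiable ℂ F) (hG : Differentiable ℂ G)
    (h : ∀ z : ℂ, 0 < z.im → F z = G z) : F = G := by
  have hev : F =ᶠ[𝓝 I] G := by
    filter_upwards [(isOpen_lt continuous_const continuous_im).mem_nhds
      (show (0 : ℝ) < I.im by simp)] with z hz
    exact h z hz
  exact AnalyticOnNhd.eq_of_eventuallyEq (fun z _ => hF.analyticAt z)
    (fun z _ => hG.analyticAt z) hev

/-- Every `F` in the de Branges space is the transform of `T* F`, where `T` is the transform: the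
value at `w` of the transform of `T* F` is `⟨T k_w, F⟩ = F(w)`. -/
theorem exists_adjoint (h : IsKernelExpansion E e) (F : DeBrangesSpace E) :
    ∃ v : lp (fun _ : ℤ => ℂ) 2, transform e v = F.toFun ∧
      ∀ g, inner ℂ v g = inner ℂ F (h.transformCLM g) := by
  set v := (InnerProductSpace.toDual ℂ (lp (fun _ : ℤ => ℂ) 2)).symm
    ((innerSL ℂ F).comp h.transformCLM) with hv
  have hvg : ∀ g, inner ℂ v g = inner ℂ F (h.transformCLM g) := fun g => by
    rw [hv, InnerProductSpace.toDual_symm_apply]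
    rfl
  refine ⟨v, eq_of_eq_upperHalfPlane (h.differentiable_transform v) F.toFun_mem.1 fun w hw => ?_,
    hvg⟩
  rw [h.transform_eq_inner, ← inner_conj_symm, hvg, inner_conj_symm,
    h.inner_kernelVector_transform F hw]

end IsKernelExpansion

/-! ### Solutions of the Jacobi equation near `-∞` -/

theorem jacobiWronskian_sub {a b : ℤ → ℝ} {f g : ℤ → ℂ} {w z : ℂ}
    (hf : ∀ n, jacobiTau a b f n = w * f n) (hg : ∀ n, jacobiTau a b g n = z * g n) (n : ℤ) :
    jacobiWronskian a f g n - jacobiWronskian a f g (n - 1) = (z - w) * (f n * g n) := by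
  have h1 := hf n
  have h2 := hg n
  simp only [jacobiTau, jacobiWronskian, sub_add_cancel] at *
  linear_combination f n * h2 - g n * h1

theorem jacobi_solution_eq_zero {a b : ℤ → ℝ} (ha : ∀ n, 0 < a n) {f : ℤ → ℂ} {z : ℂ}
    (hf : ∀ n, jacobiTau a b f n = z * f n) {n : ℤ} (h0 : f n = 0) (h1 : f (n + 1) = 0) :
    f = 0 := by
  have ha' : ∀ m, (a m : ℂ) ≠ 0 := fun m => by exact_mod_cast (ha m).ne'
  have hup : ∀ k : ℕ, f (n + k) = 0 ∧ f (n + k + 1) = 0 := by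
    intro k
    induction k with
    | zero => simpa using ⟨h0, h1⟩
    | succ k ih =>
      have h := hf (n + k + 1)
      simp only [jacobiTau, add_sub_cancel_right, ih.1, ih.2, mul_zero, add_zero, mul_eq_zero,
        ha', false_or] at h
      push_cast
      rw [← add_assoc]
      exact ⟨ih.2, h⟩
  have hdown : ∀ k : ℕ, f (n - k) = 0 ∧ f (n - k + 1) = 0 := by
    intro k
    induction k with
    | zero => simpa using ⟨h0, h1⟩
    | succ k ih =>
      have h := hf (n - k)
      simp only [jacobiTau, ih.1, ih.2, mul_zero, add_zero, zero_add, mul_eq_zero, ha',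
        false_or] at h
      push_cast
      rw [← sub_sub, sub_add_cancel]
      exact ⟨h, ih.1⟩
  funext m
  rcases le_total n m with hm | hm
  · obtain ⟨k, rfl⟩ := Int.le.dest hm
    exact (hup k).1
  · obtain ⟨k, hk⟩ := Int.le.dest hm
    have := (hdown k).1
    rwa [← hk, add_sub_cancel_right] at this

theorem SqSummableNearBot.summable_sub {f : ℤ → ℂ} (hf : SqSummableNearBot f) (n : ℤ) :
    Summable fun k : ℕ => ‖f (n - k)‖ ^ 2 := by
  obtain ⟨p, rfl | rfl⟩ := n.eq_nat_or_neg
  · rw [← summable_nat_add_iff p]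
    refine hf.congr fun k => ?_
    push_cast
    congr 3
    ring
  · refine ((summable_nat_add_iff p).2 hf).congr fun k => ?_
    push_cast
    congr 3
    ring

theorem summable_mul_of_sq {f g : ℕ → ℂ} (hf : Summable fun k => ‖f k‖ ^ 2)
    (hg : Summable fun k => ‖g k‖ ^ 2) : Summable fun k => f k * g k := by
  refine Summable.of_norm_bounded (hf.add hg) fun k => ?_
  rw [norm_mul]
  nlinarith [sq_nonneg (‖f k‖ - ‖g k‖), sq_nonneg ‖f k‖, sq_nonneg ‖g k‖]

theorem tendsto_sub_natCast_atBot (n : ℤ) : Tendsto (fun k : ℕ => n - (k : ℤ)) atTop atBot :=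
  tendsto_atBot_add_const_left atTop n
    (tendsto_neg_atTop_atBot.comp tendsto_natCast_atTop_atTop) |>.congr fun k => by
      simp [sub_eq_add_neg]

/-- The partial sums in the Christoffel–Darboux formula. -/
theorem jacobiWronskian_telescope {a b : ℤ → ℝ} {f g : ℤ → ℂ} {w z : ℂ}
    (hf : ∀ n, jacobiTau a b f n = w * f n) (hg : ∀ n, jacobiTau a b g n = z * g n) (n : ℤ)
    (k : ℕ) : (z - w) * ∑ j ∈ Finset.range k, f (n - j) * g (n - j) =
      jacobiWronskian a f g n - jacobiWronskian a f g (n - k) := by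
  induction k with
  | zero => simp
  | succ k ih =>
    rw [Finset.sum_range_succ, mul_add, ih, ← jacobiWronskian_sub hf hg (n - k)]
    push_cast
    rw [← sub_sub]
    ring

theorem exists_tendsto_jacobiWronskian {a b : ℤ → ℝ} {f g : ℤ → ℂ} {w z : ℂ}
    (hf : ∀ n, jacobiTau a b f n = w * f n) (hg : ∀ n, jacobiTau a b g n = z * g n)
    (hf2 : SqSummableNearBot f) (hg2 : SqSummableNearBot g) (n : ℤ) :
    ∃ c, Tendsto (fun k : ℕ => jacobiWronskian a f g (n - k)) atTop (𝓝 c) := by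
  have h1 := (summable_mul_of_sq (hf2.summable_sub n) (hg2.summable_sub n)).hasSum.tendsto_sum_nat
  refine ⟨_, ((h1.const_mul (z - w)).const_sub (jacobiWronskian a f g n)).congr fun k => ?_⟩
  rw [jacobiWronskian_telescope hf hg]
  ring

/-- A Gronwall inequality running to `-∞`: if `x k ≤ x (k + 1) (1 + q k)` with `q` summable and
`x → 0`, then `x 0 = 0`. -/
theorem nonpos_of_le_mul_of_tendsto_zero {x q : ℕ → ℝ} (hx : ∀ k, 0 ≤ x k) (hq : ∀ k, 0 ≤ q k)
    (hqs : Summable q) (h : ∀ k, x k ≤ x (k + 1) * (1 + q k)) (hlim : Tendsto x atTop (𝓝 0)) :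
    x 0 ≤ 0 := by
  have h1 : ∀ k, x 0 ≤ x k * Real.exp (∑ j ∈ Finset.range k, q j) := by
    intro k
    induction k with
    | zero => simp
    | succ k ih =>
      refine ih.trans ?_
      rw [Finset.sum_range_succ, Real.exp_add, mul_comm (Real.exp _), ← mul_assoc]
      refine mul_le_mul_of_nonneg_right ((h k).trans ?_) (Real.exp_pos _).le
      refine mul_le_mul_of_nonneg_left ?_ (hx _)
      linarith [Real.add_one_le_exp (q k)]
  have h2 : ∀ k, x 0 ≤ x k * Real.exp (∑' j, q j) := fun k =>
    (h1 k).trans (mul_le_mul_of_nonneg_left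
      (Real.exp_le_exp.2 (hqs.sum_le_tsum _ fun j _ => hq j)) (hx k))
  have h3 := hlim.mul_const (Real.exp (∑' j, q j))
  rw [zero_mul] at h3
  exact ge_of_tendsto' h3 h2

/-- Two square summable solutions which satisfy the boundary condition given by `u` have vanishing
Wronskian at `-∞`. Otherwise they form there an asymptotic basis, in which `u` has coefficients
`W(u, f)` and `W(u, g)` up to bounded factors; these tend to zero, and a Gronwall estimate
shows that they vanish. -/
theorem tendsto_jacobiWronskian_zero {a b : ℤ → ℝ} (ha : ∀ n, 0 < a n) {u f g : ℤ → ℂ}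
    {z₀ w z : ℂ} (hu : ∀ n, jacobiTau a b u n = z₀ * u n) (hu0 : u ≠ 0)
    (hf : ∀ n, jacobiTau a b f n = w * f n) (hg : ∀ n, jacobiTau a b g n = z * g n)
    (hf2 : SqSummableNearBot f) (hg2 : SqSummableNearBot g)
    (huf : Tendsto (jacobiWronskian a u f) atBot (𝓝 0))
    (hug : Tendsto (jacobiWronskian a u g) atBot (𝓝 0)) (n : ℤ) :
    Tendsto (fun k : ℕ => jacobiWronskian a f g (n - k)) atTop (𝓝 0) := by
  obtain ⟨c, hc⟩ := exists_tendsto_jacobiWronskian hf hg hf2 hg2 n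
  by_cases hc0 : c = 0
  · rwa [hc0] at hc
  exfalso
  set δ := ‖c‖ / 2 with hδ
  have hcpos : 0 < ‖c‖ := norm_pos_iff.2 hc0
  have hδ0 : 0 < δ := by positivity
  obtain ⟨K, hK⟩ := eventually_atTop.1 (hc.norm.eventually_const_le (by linarith : δ < ‖c‖))
  set N : ℤ := n - K with hN
  have hlow : ∀ k : ℕ, δ ≤ ‖jacobiWronskian a f g (N - k)‖ := fun k => by
    have := hK (K + k) (by omega)
    rwa [Nat.cast_add, ← sub_sub] at this
  set x : ℕ → ℝ := fun k => ‖jacobiWronskian a u f (N - k)‖ + ‖jacobiWronskian a u g (N - k)‖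
    with hx
  have hx0 : ∀ k, 0 ≤ x k := fun k => by positivity
  set D := ‖w - z₀‖ + ‖z - z₀‖ with hD
  have hD0 : 0 ≤ D := by positivity
  set q : ℕ → ℝ := fun k => 2 * D / δ * (‖f (N - k)‖ ^ 2 + ‖g (N - k)‖ ^ 2) with hq
  have hq0 : ∀ k, 0 ≤ q k := fun k => by positivity
  have hqs : Summable q := ((hf2.summable_sub N).add (hg2.summable_sub N)).mul_left _
  have hlim : Tendsto x atTop (𝓝 0) := by
    have := (huf.comp (tendsto_sub_natCast_atBot N)).norm.add
      (hug.comp (tendsto_sub_natCast_atBot N)).norm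
    simpa using this
  have hstep : ∀ k, x k ≤ x (k + 1) * (1 + q k) := by
    intro k
    set m : ℤ := N - k with hm
    have hm1 : N - ((k + 1 : ℕ) : ℤ) = m - 1 := by rw [hm]; push_cast; ring
    have hl := hlow (k + 1)
    simp only [hx, hq]
    rw [hm1] at hl ⊢
    have e1 := jacobiWronskian_sub hu hf m
    have e2 := jacobiWronskian_sub hu hg m
    have e3 : u m * jacobiWronskian a f g (m - 1) =
        f m * jacobiWronskian a u g (m - 1) - g m * jacobiWronskian a u f (m - 1) := by
      simp only [jacobiWronskian, sub_add_cancel]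
      ring
    set P := jacobiWronskian a u f (m - 1)
    set Q := jacobiWronskian a u g (m - 1)
    have n1 : ‖jacobiWronskian a u f m‖ ≤ ‖P‖ + ‖w - z₀‖ * (‖u m‖ * ‖f m‖) := by
      rw [sub_eq_iff_eq_add.1 e1, add_comm]
      exact (norm_add_le _ _).trans_eq (by rw [norm_mul, norm_mul])
    have n2 : ‖jacobiWronskian a u g m‖ ≤ ‖Q‖ + ‖z - z₀‖ * (‖u m‖ * ‖g m‖) := by
      rw [sub_eq_iff_eq_add.1 e2, add_comm]
      exact (norm_add_le _ _).trans_eq (by rw [norm_mul, norm_mul])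
    have n3 : ‖u m‖ * δ ≤ (‖f m‖ + ‖g m‖) * (‖P‖ + ‖Q‖) := by
      refine (mul_le_mul_of_nonneg_left hl (norm_nonneg _)).trans ?_
      rw [← norm_mul, e3]
      refine (norm_sub_le _ _).trans ?_
      rw [norm_mul, norm_mul]
      nlinarith [mul_nonneg (norm_nonneg (f m)) (norm_nonneg P),
        mul_nonneg (norm_nonneg (g m)) (norm_nonneg Q)]
    have n4 : ‖u m‖ ≤ (‖f m‖ + ‖g m‖) * (‖P‖ + ‖Q‖) / δ := (le_div_iff₀ hδ0).2 n3
    calc ‖jacobiWronskian a u f m‖ + ‖jacobiWronskian a u g m‖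
        ≤ ‖P‖ + ‖Q‖ + D * (‖u m‖ * (‖f m‖ + ‖g m‖)) := by
          have t1 : 0 ≤ ‖w - z₀‖ * (‖u m‖ * ‖g m‖) := by positivity
          have t2 : 0 ≤ ‖z - z₀‖ * (‖u m‖ * ‖f m‖) := by positivity
          rw [hD]
          linarith
      _ ≤ ‖P‖ + ‖Q‖ + D * ((‖f m‖ + ‖g m‖) * (‖P‖ + ‖Q‖) / δ * (‖f m‖ + ‖g m‖)) := by
          gcongr
      _ = (‖P‖ + ‖Q‖) * (1 + D / δ * (‖f m‖ + ‖g m‖) ^ 2) := by ring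
      _ ≤ (‖P‖ + ‖Q‖) * (1 + D / δ * (2 * (‖f m‖ ^ 2 + ‖g m‖ ^ 2))) := by
          have := add_sq_le (a := ‖f m‖) (b := ‖g m‖)
          gcongr
      _ = (‖P‖ + ‖Q‖) * (1 + 2 * D / δ * (‖f m‖ ^ 2 + ‖g m‖ ^ 2)) := by ring
  have hzero := nonpos_of_le_mul_of_tendsto_zero hx0 hq0 hqs hstep hlim
  have hN1 : jacobiWronskian a u f N = 0 ∧ jacobiWronskian a u g N = 0 := by
    simp only [hx, Nat.cast_zero, sub_zero] at hzero
    have t1 := norm_nonneg (jacobiWronskian a u f N)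
    have t2 := norm_nonneg (jacobiWronskian a u g N)
    exact ⟨norm_le_zero_iff.1 (by linarith), norm_le_zero_iff.1 (by linarith)⟩
  have hfg : jacobiWronskian a f g N ≠ 0 := by
    have := hlow 0
    rw [Nat.cast_zero, sub_zero] at this
    exact norm_pos_iff.1 (hδ0.trans_le this)
  have c0 : u N * jacobiWronskian a f g N =
      f N * jacobiWronskian a u g N - g N * jacobiWronskian a u f N := by
    simp only [jacobiWronskian]
    ring
  have c1 : u (N + 1) * jacobiWronskian a f g N =
      f (N + 1) * jacobiWronskian a u g N - g (N + 1) * jacobiWronskian a u f N := by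
    simp only [jacobiWronskian]
    ring
  rw [hN1.1, hN1.2, mul_zero, mul_zero, sub_zero, mul_eq_zero, or_iff_left hfg] at c0 c1
  exact hu0 (jacobi_solution_eq_zero ha hu c0 c1)

/-! ### The Christoffel–Darboux formula -/

/-- The values `φ(z, m)` for `m ≤ n`, continued by zero to all of `ℤ`. -/
def jacobiTruncation (φ : ℂ → ℤ → ℂ) (n m : ℤ) (z : ℂ) : ℂ := if m ≤ n then φ z m else 0

theorem hasSum_int_of_hasSum_nat {α : Type*} [AddCommMonoid α] [TopologicalSpace α] {F : ℤ → α}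
    {n : ℤ} (h0 : ∀ m, n < m → F m = 0) {s : α} (h : HasSum (fun k : ℕ => F (n - k)) s) :
    HasSum F s := by
  have hinj : Function.Injective fun k : ℕ => n - (k : ℤ) := fun k l hkl => by
    simpa using hkl
  refine (hinj.hasSum_iff fun m hm => h0 m ?_).1 h
  by_contra! hmn
  exact hm ⟨(n - m).toNat, by simp only []; omega⟩

theorem jacobiTruncation_sub (φ : ℂ → ℤ → ℂ) (n : ℤ) (k : ℕ) (z : ℂ) :
    jacobiTruncation φ n (n - k) z = φ z (n - k) := by
  rw [jacobiTruncation, if_pos (by omega)]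

theorem jacobiTruncation_of_lt (φ : ℂ → ℤ → ℂ) {n m : ℤ} (h : n < m) (z : ℂ) :
    jacobiTruncation φ n m z = 0 := if_neg (by omega)

namespace IsRealEntireSolution

variable {a b : ℤ → ℝ} {u : ℤ → ℂ} {φ : ℂ → ℤ → ℂ}

theorem eq_zero_imp (hφ : IsRealEntireSolution a b u φ) (ha : ∀ n, 0 < a n) {z : ℂ} {n : ℤ}
    (h0 : φ z n = 0) (h1 : φ z (n + 1) = 0) : False :=
  hφ.nontrivial z (jacobi_solution_eq_zero ha (hφ.solution z) h0 h1)

theorem summable_truncation (hφ : IsRealEntireSolution a b u φ) (n : ℤ) (z : ℂ) :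
    Summable fun m => ‖jacobiTruncation φ n m z‖ ^ 2 := by
  have h := ((hφ.inDomain z).sqSummable.summable_sub n).hasSum
  refine (hasSum_int_of_hasSum_nat (s := ∑' k : ℕ, ‖φ z (n - k)‖ ^ 2) (n := n)
    (fun m hm => ?_) ?_).summable
  · simp [jacobiTruncation_of_lt φ hm]
  · simpa only [jacobiTruncation_sub] using h

theorem mul_tsum_truncation (hφ : IsRealEntireSolution a b u φ) (ha : ∀ n, 0 < a n) {z₀ : ℂ}
    (hu : IsLeftBoundarySolution a b z₀ u) (n : ℤ) (w z : ℂ) :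
    (z - conj w) * ∑' m, conj (jacobiTruncation φ n m w) * jacobiTruncation φ n m z =
      jacobiWronskian a (φ (conj w)) (φ z) n := by
  have hs := (summable_mul_of_sq ((hφ.inDomain (conj w)).sqSummable.summable_sub n)
    ((hφ.inDomain z).sqSummable.summable_sub n)).hasSum
  have h1 : HasSum (fun m => conj (jacobiTruncation φ n m w) * jacobiTruncation φ n m z)
      (∑' k : ℕ, φ (conj w) (n - k) * φ z (n - k)) := by
    refine hasSum_int_of_hasSum_nat (n := n) (fun m hm => ?_) ?_
    · rw [jacobiTruncation_of_lt φ hm z, mul_zero]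
    · simpa only [jacobiTruncation_sub, ← hφ.real] using hs
  rw [h1.tsum_eq]
  have h2 := tendsto_jacobiWronskian_zero ha hu.solution hu.nontrivial (hφ.solution (conj w))
    (hφ.solution z) (hφ.inDomain (conj w)).sqSummable (hφ.inDomain z).sqSummable
    (hφ.inDomain (conj w)).boundary (hφ.inDomain z).boundary n
  have h3 := h2.const_sub (jacobiWronskian a (φ (conj w)) (φ z) n)
  rw [sub_zero] at h3
  refine tendsto_nhds_unique (hs.tendsto_sum_nat.const_mul (z - conj w)) (h3.congr fun k => ?_)
  rw [jacobiWronskian_telescope (hφ.solution (conj w)) (hφ.solution z)]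

theorem conj_jacobiE (hφ : IsRealEntireSolution a b u φ) (n : ℤ) (w : ℂ) :
    conj (jacobiE a φ n w) = φ (conj w) n + I * a n * φ (conj w) (n + 1) := by
  simp only [jacobiE, map_sub, map_mul, conj_I, conj_ofReal, hφ.real]
  ring

theorem kernel_jacobiE (hφ : IsRealEntireSolution a b u φ) (ha : ∀ n, 0 < a n) {z₀ : ℂ}
    (hu : IsLeftBoundarySolution a b z₀ u) (n : ℤ) (w z : ℂ) :
    2 * I * (conj w - z) *
        ∑' m, conj (jacobiTruncation φ n m w) * jacobiTruncation φ n m z =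
      jacobiE a φ n z * conj (jacobiE a φ n w) -
        conj (jacobiE a φ n (conj z)) * jacobiE a φ n (conj w) := by
  have h := hφ.mul_tsum_truncation ha hu n w z
  rw [hφ.conj_jacobiE, hφ.conj_jacobiE, conj_conj]
  simp only [jacobiE, jacobiWronskian] at *
  linear_combination (-2 * I) * h

theorem tsum_truncation_pos (hφ : IsRealEntireSolution a b u φ) (ha : ∀ n, 0 < a n) (n : ℤ)
    (z : ℂ) : 0 < ∑' m, ‖jacobiTruncation φ n m z‖ ^ 2 := by
  obtain ⟨m, hm, hm0⟩ : ∃ m ≤ n, φ z m ≠ 0 := by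
    by_contra! h
    exact hφ.eq_zero_imp ha (h (n - 1) (by omega)) (h (n - 1 + 1) (by omega))
  refine (hφ.summable_truncation n z).tsum_pos (fun m => sq_nonneg _) m ?_
  rw [jacobiTruncation, if_pos hm]
  have := norm_pos_iff.2 hm0
  positivity

theorem norm_jacobiE_conj_lt (hφ : IsRealEntireSolution a b u φ) (ha : ∀ n, 0 < a n) {z₀ : ℂ}
    (hu : IsLeftBoundarySolution a b z₀ u) (n : ℤ) {z : ℂ} (hz : 0 < z.im) :
    ‖jacobiE a φ n (conj z)‖ < ‖jacobiE a φ n z‖ := by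
  have h1 := four_im_mul_tsum_of_kernel (hφ.kernel_jacobiE ha hu n z z)
  have h2 := mul_pos hz (hφ.tsum_truncation_pos ha n z)
  refine lt_of_pow_lt_pow_left₀ 2 (norm_nonneg _) ?_
  linarith

theorem jacobiE_ne_zero (hφ : IsRealEntireSolution a b u φ) (ha : ∀ n, 0 < a n) {z₀ : ℂ}
    (hu : IsLeftBoundarySolution a b z₀ u) (n : ℤ) {z : ℂ} (hz : 0 ≤ z.im) :
    jacobiE a φ n z ≠ 0 := by
  rcases hz.eq_or_lt with h | h
  · intro h0
    have hc : conj z = z := conj_eq_iff_im.2 h.symm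
    have h1 := hφ.conj_jacobiE n z
    rw [h0, hc, map_zero] at h1
    rw [jacobiE] at h0
    have h2 : φ z n = 0 := by linear_combination (h0 - h1) / 2
    have h3 : (I * a n) * φ z (n + 1) = 0 := by linear_combination (-h0 - h1) / 2
    have h4 : I * (a n : ℂ) ≠ 0 := mul_ne_zero I_ne_zero (by exact_mod_cast (ha n).ne')
    exact hφ.eq_zero_imp ha h2 ((mul_eq_zero.1 h3).resolve_left h4)
  · exact norm_pos_iff.1 ((norm_nonneg _).trans_lt (hφ.norm_jacobiE_conj_lt ha hu n h))

theorem differentiable_jacobiE (hφ : IsRealEntireSolution a b u φ) (n : ℤ) :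
    Differentiable ℂ (jacobiE a φ n) :=
  (hφ.entire n).sub ((hφ.entire (n + 1)).const_mul _)

/-- The Christoffel–Darboux formula: the functions `φ(·, m)`, `m ≤ n`, expand the reproducing
kernel of the de Branges space of `E(·, n)`. -/
theorem isKernelExpansion (hφ : IsRealEntireSolution a b u φ) (ha : ∀ n, 0 < a n) {z₀ : ℂ}
    (hu : IsLeftBoundarySolution a b z₀ u) (n : ℤ) :
    IsKernelExpansion (jacobiE a φ n) (jacobiTruncation φ n) where
  differentiable_E := hφ.differentiable_jacobiE n
  ne_zero _ hz := hφ.jacobiE_ne_zero ha hu n hz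
  differentiable m := by
    by_cases h : m ≤ n
    · rw [show jacobiTruncation φ n m = fun z => φ z m from funext fun z => if_pos h]
      exact hφ.entire m
    · rw [show jacobiTruncation φ n m = fun _ => 0 from funext fun z => if_neg h]
      exact differentiable_const 0
  real m z := by
    by_cases h : m ≤ n
    · simpa only [jacobiTruncation, if_pos h] using hφ.real z m
    · simp only [jacobiTruncation, if_neg h, map_zero]
  sqSummable := hφ.summable_truncation n
  kernel := hφ.kernel_jacobiE ha hu n

end IsRealEntireSolution

/-! ### Injectivity of the transform -/

theorem IsKernelExpansion.transform_single {E : ℂ → ℂ} {e : ℤ → ℂ → ℂ}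
    (h : IsKernelExpansion E e) (m : ℤ) (c z : ℂ) :
    transform e (lp.single 2 m c : lp (fun _ : ℤ => ℂ) 2) z = e m z * c := by
  rw [h.transform_eq_inner, lp.inner_single_right, RCLike.inner_apply, h.kernelVector_apply,
    conj_conj, mul_comm]

open IsKernelExpansion (transform)

theorem truncation_mul {φ : ℂ → ℤ → ℂ} {n : ℤ} {f : lp (fun _ : ℤ => ℂ) 2}
    (hf : f ∈ ellTwoUpTo n) (z : ℂ) (m : ℤ) : jacobiTruncation φ n m z * f m = φ z m * f m := by
  by_cases h : m ≤ n
  · rw [jacobiTruncation, if_pos h]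
  · rw [hf m (by omega), mul_zero, mul_zero]

theorem transform_truncation {φ : ℂ → ℤ → ℂ} {n : ℤ} {f : lp (fun _ : ℤ => ℂ) 2}
    (hf : f ∈ ellTwoUpTo n) : transform (jacobiTruncation φ n) f = jacobiTransform φ f :=
  funext fun z => tsum_congr fun m => truncation_mul hf z m

theorem not_mem_deBrangesSubmodule_self {E : ℂ → ℂ} (hE : ∀ z : ℂ, 0 ≤ z.im → E z ≠ 0) :
    E ∉ deBrangesSubmodule E := by
  rintro ⟨-, h, -⟩
  have h1 : (fun x : ℝ => E x / E x) = fun _ => (1 : ℂ) :=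
    funext fun x => div_self (hE x (by simp))
  rw [h1, memLp_const_iff two_ne_zero ENNReal.ofNat_ne_top] at h
  simp at h

theorem exists_last_ne_zero {f : ℤ → ℂ} {n : ℤ} (hf : ∀ m, n < m → f m = 0) (h0 : f ≠ 0) :
    ∃ m, f m ≠ 0 ∧ ∀ l, m < l → f l = 0 := by
  obtain ⟨m₁, hm₁⟩ := Function.ne_iff.1 h0
  obtain ⟨m, hm, hmax⟩ := Int.exists_greatest_of_bdd (P := fun m => f m ≠ 0)
    ⟨n, fun m hm => by by_contra! h; exact hm (hf m h)⟩ ⟨m₁, hm₁⟩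
  exact ⟨m, hm, fun l hl => by by_contra! h; exact absurd (hmax l h) (by omega)⟩

namespace IsRealEntireSolution

variable {a b : ℤ → ℝ} {u : ℤ → ℂ} {φ : ℂ → ℤ → ℂ}

theorem apply_mem_deBrangesSubmodule (hφ : IsRealEntireSolution a b u φ) (ha : ∀ n, 0 < a n)
    {z₀ : ℂ} (hu : IsLeftBoundarySolution a b z₀ u) {m n : ℤ} (hmn : m ≤ n) :
    (fun z => φ z m) ∈ deBrangesSubmodule (jacobiE a φ n) := by
  have h := hφ.isKernelExpansion ha hu n
  convert! h.transform_mem (lp.single 2 m 1) using 1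
  funext z
  rw [h.transform_single, jacobiTruncation, if_pos hmn, mul_one]

/-- The transform is injective. If `f ≠ 0` has zero transform and `m` is the last index with
`f m ≠ 0`, then `φ(·, m)` is the transform of a sequence supported on the indices below `m`, hence
belongs to the de Branges space of `E(·, m - 1)`. So does `φ(·, m - 1)`, and therefore also
`E(·, m - 1)` itself, which is impossible since the constant `1` is not in `L²(ℝ)`. -/
theorem transform_injective (hφ : IsRealEntireSolution a b u φ) (ha : ∀ n, 0 < a n)
    {z₀ : ℂ} (hu : IsLeftBoundarySolution a b z₀ u) {n : ℤ} {f : lp (fun _ : ℤ => ℂ) 2}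
    (hf : f ∈ ellTwoUpTo n) (h0 : transform (jacobiTruncation φ n) f = 0) : f = 0 := by
  by_contra hne
  have hne' : (f : ℤ → ℂ) ≠ 0 := fun h => hne (Subtype.ext h)
  obtain ⟨m, hm, hlast⟩ := exists_last_ne_zero hf hne'
  have hE := hφ.isKernelExpansion ha hu (m - 1)
  have hsplit : ∀ z, φ z m * f m + transform (jacobiTruncation φ (m - 1)) f z = 0 := fun z => by
    have h1 := (hE.hasSum_transform f z).add (hasSum_ite_eq m (φ z m * f m))
    rw [← hE.transform_eq_inner] at h1
    have h2 : transform (jacobiTruncation φ n) f z =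
        transform (jacobiTruncation φ (m - 1)) f z + φ z m * f m := by
      rw [← h1.tsum_eq]
      refine tsum_congr fun l => ?_
      rw [truncation_mul hf]
      rcases lt_trichotomy l m with hl | hl | hl
      · rw [jacobiTruncation, if_pos (by omega), if_neg hl.ne, add_zero]
      · rw [hl, jacobiTruncation_of_lt φ (by omega), if_pos rfl, zero_mul, zero_add]
      · rw [hlast l hl, if_neg hl.ne', mul_zero, mul_zero, add_zero]
    rw [add_comm, ← h2, h0]
    rfl
  have hmem : (fun z => φ z m) ∈ deBrangesSubmodule (jacobiE a φ (m - 1)) := by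
    have h1 := (deBrangesSubmodule (jacobiE a φ (m - 1))).smul_mem (-(f m)⁻¹) (hE.transform_mem f)
    convert! h1 using 1
    funext z
    have h2 := hsplit z
    rw [Pi.smul_apply, smul_eq_mul]
    field_simp
    linear_combination h2
  have hmem' := hφ.apply_mem_deBrangesSubmodule ha hu (le_refl (m - 1))
  refine not_mem_deBrangesSubmodule_self hE.ne_zero ?_
  have h3 := (deBrangesSubmodule (jacobiE a φ (m - 1))).sub_mem hmem'
    ((deBrangesSubmodule (jacobiE a φ (m - 1))).smul_mem (I * a (m - 1)) hmem)
  convert! h3 using 1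
  funext z
  simp [jacobiE]

/-! ### Unitarity of the transform -/

/-- Every element of the de Branges space is the transform of a sequence in `ℓ²(-∞, n]`, which is
its image under the adjoint of the transform. -/
theorem exists_transform_eq (hφ : IsRealEntireSolution a b u φ) (ha : ∀ n, 0 < a n)
    {z₀ : ℂ} (hu : IsLeftBoundarySolution a b z₀ u) {n : ℤ}
    (F : DeBrangesSpace (jacobiE a φ n)) :
    ∃ f ∈ ellTwoUpTo n, transform (jacobiTruncation φ n) f = F.toFun ∧
      ∀ g, inner ℂ f g = inner ℂ F ((hφ.isKernelExpansion ha hu n).transformCLM g) := by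
  have h := hφ.isKernelExpansion ha hu n
  obtain ⟨f, hf, hfg⟩ := h.exists_adjoint F
  refine ⟨f, fun m hm => ?_, hf, hfg⟩
  have h1 := hfg (lp.single 2 m 1)
  have h2 : h.transformCLM (lp.single 2 m 1) = 0 := Subtype.ext <| funext fun z => by
    refine (h.transform_single m 1 z).trans ?_
    rw [jacobiTruncation_of_lt φ hm, zero_mul]
    rfl
  rw [h2, inner_zero_right, lp.inner_single_right, RCLike.inner_apply, one_mul] at h1
  simpa using h1

theorem norm_transformCLM (hφ : IsRealEntireSolution a b u φ) (ha : ∀ n, 0 < a n)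
    {z₀ : ℂ} (hu : IsLeftBoundarySolution a b z₀ u) {n : ℤ} {f : lp (fun _ : ℤ => ℂ) 2}
    (hf : f ∈ ellTwoUpTo n) : ‖(hφ.isKernelExpansion ha hu n).transformCLM f‖ = ‖f‖ := by
  have h := hφ.isKernelExpansion ha hu n
  obtain ⟨v, hv, hvf, hvg⟩ := hφ.exists_transform_eq ha hu (h.transformCLM f)
  -- the adjoint of the transform is its inverse
  have hvf' : v = f := by
    refine sub_eq_zero.1 (hφ.transform_injective ha hu ((ellTwoUpTo n).sub_mem hv hf) ?_)
    funext z
    have h1 := congrFun hvf z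
    rw [h.toFun_transformCLM, h.transform_eq_inner, h.transform_eq_inner] at h1
    rw [h.transform_eq_inner, inner_sub_right, h1, sub_self]
    rfl
  have h2 := hvg f
  rw [hvf', inner_self_eq_norm_sq_to_K, inner_self_eq_norm_sq_to_K] at h2
  have h3 : ‖f‖ ^ 2 = ‖h.transformCLM f‖ ^ 2 := by exact_mod_cast h2
  exact ((sq_eq_sq₀ (norm_nonneg _) (norm_nonneg _)).1 h3).symm

/-- The unitary map `f ↦ f̂` from `ℓ²(-∞, n]` onto the de Branges space of `E(·, n)`. -/
def jacobiUnitary (hφ : IsRealEntireSolution a b u φ) (ha : ∀ n, 0 < a n)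
    {z₀ : ℂ} (hu : IsLeftBoundarySolution a b z₀ u) (n : ℤ) :
    ellTwoUpTo n ≃ₗᵢ[ℂ] DeBrangesSpace (jacobiE a φ n) :=
  LinearIsometryEquiv.ofSurjective
    ⟨(hφ.isKernelExpansion ha hu n).transformLM ∘ₗ (ellTwoUpTo n).subtype,
      fun f => hφ.norm_transformCLM ha hu f.2⟩ fun F => by
    obtain ⟨f, hf, hfF, -⟩ := hφ.exists_transform_eq ha hu F
    exact ⟨⟨f, hf⟩, Subtype.ext hfF⟩

theorem toFun_jacobiUnitary (hφ : IsRealEntireSolution a b u φ) (ha : ∀ n, 0 < a n)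
    {z₀ : ℂ} (hu : IsLeftBoundarySolution a b z₀ u) (n : ℤ) (f : ellTwoUpTo n) :
    (hφ.jacobiUnitary ha hu n f).toFun = jacobiTransform φ f.1 := transform_truncation f.2

theorem dense_span (hφ : IsRealEntireSolution a b u φ) (ha : ∀ n, 0 < a n)
    {z₀ : ℂ} (hu : IsLeftBoundarySolution a b z₀ u) (n : ℤ) :
    (Submodule.span ℂ {F : DeBrangesSpace (jacobiE a φ n) |
      ∃ m ≤ n, F.toFun = fun z => φ z m}).topologicalClosure = ⊤ := by
  set S := Submodule.span ℂ {F : DeBrangesSpace (jacobiE a φ n) |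
      ∃ m ≤ n, F.toFun = fun z => φ z m} with hS
  have h := hφ.isKernelExpansion ha hu n
  rw [eq_top_iff]
  intro F _
  obtain ⟨f, -, hfF, -⟩ := hφ.exists_transform_eq ha hu F
  have hF : F = h.transformCLM f := Subtype.ext hfF.symm
  have hsum := (lp.hasSum_single (p := 2) (by norm_num) f).mapL h.transformCLM
  rw [← hF] at hsum
  rw [← SetLike.mem_coe, Submodule.topologicalClosure_coe]
  rw [HasSum, SummationFilter.unconditional_filter] at hsum
  refine mem_closure_of_tendsto hsum (Eventually.of_forall fun s => ?_)
  refine S.sum_mem fun m _ => ?_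
  by_cases hm : m ≤ n
  · -- the transform of a multiple of a unit vector is a multiple of `φ(·, m)`
    have h1 : h.transformCLM (lp.single 2 m (f m)) = f m • h.transformCLM (lp.single 2 m 1) := by
      rw [← map_smul, ← lp.single_smul, smul_eq_mul, mul_one]
    rw [h1]
    refine S.smul_mem _ (Submodule.subset_span ⟨m, hm, ?_⟩)
    funext z
    rw [h.toFun_transformCLM, h.transform_single, jacobiTruncation, if_pos hm, mul_one]
  · have h1 : h.transformCLM (lp.single 2 m (f m)) = 0 := Subtype.ext <| funext fun z => by
      refine (h.transform_single m (f m) z).trans ?_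
      rw [jacobiTruncation_of_lt φ (by omega), zero_mul]
      rfl
    rw [h1]
    exact S.zero_mem

end IsRealEntireSolution

end

theorem theorem6p1 (a b : ℤ → ℝ) (ha : ∀ n, 0 < a n)
    (z₀ : ℂ) (u : ℤ → ℂ) (hu : IsLeftBoundarySolution a b z₀ u)
    (φ : ℂ → ℤ → ℂ) (hφ : IsRealEntireSolution a b u φ) (n : ℤ) :
    IsDeBrangesFunction (jacobiE a φ n) ∧
    (∀ f ∈ ellTwoUpTo n, ∀ z : ℂ, Summable fun m : ℤ => φ z m * f m) ∧
    (∃ U : ellTwoUpTo n ≃ₗᵢ[ℂ] DeBrangesSpace (jacobiE a φ n),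
      ∀ f : ellTwoUpTo n, (U f).toFun = jacobiTransform φ f.1) ∧
    ((deBrangesSubmodule (jacobiE a φ n) : Set (ℂ → ℂ)) =
      {F | ∃ f ∈ ellTwoUpTo n, F = jacobiTransform φ f}) ∧
    (∀ m ≤ n, (fun z => φ z m) ∈ deBrangesSubmodule (jacobiE a φ n)) ∧
    (Submodule.span ℂ {F : DeBrangesSpace (jacobiE a φ n) |
      ∃ m ≤ n, F.toFun = fun z => φ z m}).topologicalClosure = ⊤ := by
  have h := hφ.isKernelExpansion ha hu n
  refine ⟨⟨h.differentiable_E, fun z hz => hφ.norm_jacobiE_conj_lt ha hu n hz⟩, fun f hf z => ?_,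
    ⟨hφ.jacobiUnitary ha hu n, hφ.toFun_jacobiUnitary ha hu n⟩, ?_,
    fun m hm => hφ.apply_mem_deBrangesSubmodule ha hu hm, hφ.dense_span ha hu n⟩
  · exact (h.hasSum_transform f z).summable.congr fun m => truncation_mul hf z m
  · ext F
    constructor
    · intro hF
      obtain ⟨f, hf, hfF, -⟩ := hφ.exists_transform_eq ha hu (n := n) ⟨F, hF⟩
      exact ⟨f, hf, hfF.symm.trans (transform_truncation hf)⟩
    · rintro ⟨f, hf, rfl⟩
      rw [← transform_truncation hf]
      exact h.transform_mem f
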